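/- Let $N\ge 2$, let $A$ be a subset of the set $\{1,\dots,N\}$ of qubits, $B$ its complement, $N_A=|A|$, $N_B=|B|$. Start from an arbitrary unit vector $\psi_0\in(\mathbb C^2)^{\otimes N}$. At each step, independently of all other steps, choose $U$ and $V$ independently from Haar measure on $U(2)$ and, independently of these, an ordered pair $(c,d)$ of distinct qubits uniformly amongst all such pairs; apply $U$ to qubit $c$ and $V$ to qubit $d$, and then a CNOT with control qubit $c$ and target qubit $d$. Let $\psi_n$ be the random state after $n$ steps and $\rho_{A,n}=\mathrm{Tr}_B\,|\psi_n\rangle\langle\psi_n|$ its reduced density matrix on $A$. Then for every $n\ge 0$, $$\left|\mathbb E\,\mathrm{Tr}(\rho_{A,n}^2)-\frac{2^{N_A}+2^{N_B}}{2^N+1}\right|\le 4^N\exp\left(-\frac{4n}{9N(N-1)}\right).$$ -/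

import Mathlib

open MeasureTheory ProbabilityTheory

namespace RandomCircuit

/-- The group `U(2)` of one-qubit unitaries (Mathlib's topology: that of the matrix entries). -/
abbrev U2 : Type := Matrix.unitaryGroup (Fin 2) ℂ

noncomputable instance : MeasurableSpace U2 := borel U2

instance : BorelSpace U2 := ⟨rfl⟩

/-- `U(2)` is compact: it is closed and its entries are bounded by `1`. -/
instance : CompactSpace U2 := by
  have hclosed : IsClosed {M : Matrix (Fin 2) (Fin 2) ℂ | star M * M = 1 ∧ M * star M = 1} :=
    (isClosed_eq (continuous_star.mul continuous_id) continuous_const).inter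
      (isClosed_eq (continuous_id.mul continuous_star) continuous_const)
  have hcpt : IsCompact (Set.univ.pi fun _ : Fin 2 => Set.univ.pi fun _ : Fin 2 =>
      Metric.closedBall (0 : ℂ) 1) :=
    isCompact_univ_pi fun _ => isCompact_univ_pi fun _ => isCompact_closedBall 0 1
  have hset : {M : Matrix (Fin 2) (Fin 2) ℂ | star M * M = 1 ∧ M * star M = 1} ⊆
      (Set.univ.pi fun _ : Fin 2 => Set.univ.pi fun _ : Fin 2 =>
        Metric.closedBall (0 : ℂ) 1) := by
    intro M hM i _ j _
    have hu : M ∈ Matrix.unitaryGroup (Fin 2) ℂ := Unitary.mem_iff.2 hM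
    simpa using entry_norm_bound_of_unitary hu i j
  have hc := IsCompact.of_isClosed_subset hcpt hclosed hset
  have he : ((Matrix.unitaryGroup (Fin 2) ℂ : Submonoid _) : Set (Matrix (Fin 2) (Fin 2) ℂ)) =
      {M | star M * M = 1 ∧ M * star M = 1} := by
    ext M
    exact Unitary.mem_iff
  exact isCompact_iff_compactSpace.1 (he ▸ hc)

/-- Haar measure on `U(2)`, normalized to total mass one. -/
noncomputable def haarU2 : Measure U2 := Measure.haarMeasure ⊤

/-- Ordered pairs `(c, d)` of distinct qubits: control `c` and target `d`. -/
abbrev QubitPair (N : ℕ) : Type := {p : Fin N × Fin N // p.1 ≠ p.2}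

/-- The random data of one step: the unitaries `U` and `V`, and the pair `(c, d)`. -/
abbrev StepData (N : ℕ) : Type := (U2 × U2) × QubitPair N

/-- The law of one step: `U` and `V` are Haar distributed, `(c, d)` is uniform amongst all ordered
pairs of distinct qubits, and the three are independent. -/
noncomputable def stepLaw (N : ℕ) : Measure (StepData N) :=
  (haarU2.prod haarU2).prod (uniformOn Set.univ)

/-- Computational basis labels of an `N`-qubit register. -/
abbrev Bits (N : ℕ) : Type := Fin N → Fin 2

/-- The `N`-qubit Hilbert space. -/
abbrev QState (N : ℕ) : Type := EuclideanSpace ℂ (Bits N)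

/-- The one-qubit operator `U` acting on qubit `c`, identity on all other qubits. -/
def onQubit {N : ℕ} (c : Fin N) (U : Matrix (Fin 2) (Fin 2) ℂ) : Matrix (Bits N) (Bits N) ℂ :=
  fun x y => if ∀ i, i ≠ c → x i = y i then U (x c) (y c) else 0

/-- The CNOT gate with control qubit `c` and target qubit `d`: it sends the basis vector labelled
`y` to the one where bit `d` is replaced by `y d + y c` (mod 2). -/
def cnot {N : ℕ} (c d : Fin N) : Matrix (Bits N) (Bits N) ℂ :=
  fun x y => if x = Function.update y d (y d + y c) then 1 else 0

/-- The `N`-qubit operator applied in one step: `U` on `c` and `V` on `d`, then CNOT. -/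
def stepOp {N : ℕ} (g : StepData N) : Matrix (Bits N) (Bits N) ℂ :=
  cnot g.2.1.1 g.2.1.2 * (onQubit g.2.1.1 g.1.1.1 * onQubit g.2.1.2 g.1.2.1)

/-- The state after `n` steps with step data `g 0, …, g (n - 1)`, started from `ψ₀`. -/
noncomputable def evolve {N : ℕ} (g : ℕ → StepData N) (ψ₀ : QState N) : ℕ → QState N
  | 0 => ψ₀
  | n + 1 => WithLp.toLp 2 ((stepOp (g n)).mulVec (evolve g ψ₀ n).ofLp)

/-- The density matrix `|ψ⟩⟨ψ|`. -/
def ketbra {N : ℕ} (ψ : QState N) : Matrix (Bits N) (Bits N) ℂ :=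
  fun x y => ψ x * star (ψ y)

/-- The label that equals `a` on the qubits in `A` and `b` on the others. -/
def glue {N : ℕ} (A : Finset (Fin N)) (a : {i // i ∈ A} → Fin 2) (b : {i // i ∉ A} → Fin 2) :
    Bits N :=
  fun i => if h : i ∈ A then a ⟨i, h⟩ else b ⟨i, h⟩

/-- Partial trace over the qubits outside `A`. -/
def reduce {N : ℕ} (A : Finset (Fin N)) (M : Matrix (Bits N) (Bits N) ℂ) :
    Matrix ({i // i ∈ A} → Fin 2) ({i // i ∈ A} → Fin 2) ℂ :=
  fun a a' => ∑ b : {i // i ∉ A} → Fin 2, M (glue A a b) (glue A a' b)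

/-- The purity `Tr(ρ_A²)` of the reduced state `ρ_A` of `ψ` on the qubits in `A`. The trace is a
real number because `ρ_A` is Hermitian. -/
def purity {N : ℕ} (A : Finset (Fin N)) (ψ : QState N) : ℝ :=
  ((reduce A (ketbra ψ) * reduce A (ketbra ψ)).trace).re

end RandomCircuit

/-!
Expand the purity in Pauli strings. On two copies of the state, the swap of the qubits in `A` is a
combination (`purityCoeff`) of the operators `pauliAvg = (X⊗X + Y⊗Y + Z⊗Z)/3` on the qubits of a
set `T ⊆ A` and the identity elsewhere, so that the purity is linear in the profile
`T ↦ profileOf ψ T`, the mean square of the Pauli expectations with support `T` (`purity_eq_sum`).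

The expected profile evolves linearly. A Haar random one-qubit unitary replaces every non-identity
Pauli `σ ⊗ σ` by `pauliAvg`: by left invariance under a Clifford unitary permuting `X`, `Y`, `Z`
cyclically the three averages agree, and their mean is a combination of the identity and the swap
and so is not changed by `U ⊗ U` (`integral_expect_onQubit`). A CNOT permutes Pauli strings
(`expect_cnot`). Hence one gate on `(c, d)` acts on profiles by the matrix `gateStep`, and, the
steps being independent, the expected profile evolves by the average `avgStep` over all pairs
(`integral_profileOf_succ`).

With respect to the weight `3 ^ |T|` the matrix `gateStep` is symmetric. It fixes the functions that
are constant on the three nonempty configurations of `(c, d)`, and has eigenvalues `1/3` and `-1/9`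
on their orthogonal complement, whence
`‖gateStep u‖² ≤ ‖u‖² - (8/9) * pairVar c d u`. The sum of the local variances `pairVar` over all
pairs dominates the global variance (`two_mul_supportVar_le_pairVarSum`). This Poincaré inequality
is proved by induction on the number of sites: removing one of `m + 1` sites gives `m + 1`
projections (conditional expectations given the removed site and whether the other sites are empty)
which are almost orthogonal on functions of mean zero, so that the sum of these projections has norm
at most two there (`supportVar_le_sum_insertNth`). Thus the distance of the expected profile to the
stationary one contracts by `1 - 16/(9N(N-1))` in square per step. Initially the profile is bounded
by one, by Schur's test (`abs_profileOf_le`), and the Cauchy–Schwarz inequality transfers the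
estimate to the purity.
-/

namespace RandomCircuit

/-! ### Weighted sums over supports -/

/-- Weight of one site of a support: a non-identity label can be `X`, `Y` or `Z`. -/
noncomputable def siteWeight (b : Bool) : ℝ := if b then 3 else 1

/-- The number of Pauli strings with support `T` (a subset of the qubits, encoded by its indicator
function). -/
noncomputable def weight {m : ℕ} (T : Fin m → Bool) : ℝ := ∏ i, siteWeight (T i)

lemma siteWeight_pos (b : Bool) : 0 < siteWeight b := by
  unfold siteWeight; split_ifs <;> norm_num

lemma weight_pos {m : ℕ} (T : Fin m → Bool) : 0 < weight T :=
  Finset.prod_pos fun _ _ => siteWeight_pos _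

lemma weight_bot {m : ℕ} : weight (⊥ : Fin m → Bool) = 1 := by
  simp [weight, siteWeight]

lemma sum_insertNth {κ M : Type*} [Fintype κ] [AddCommMonoid M] {m : ℕ} (k : Fin (m + 1))
    (F : (Fin (m + 1) → κ) → M) :
    ∑ T, F T = ∑ t, ∑ S : Fin m → κ, F (k.insertNth t S) := by
  rw [← (Fin.insertNthEquiv (fun _ => κ) k).sum_comp F, Fintype.sum_prod_type]
  rfl

lemma weight_insertNth {m : ℕ} (k : Fin (m + 1)) (t : Bool) (S : Fin m → Bool) :
    weight (k.insertNth (α := fun _ => Bool) t S) = siteWeight t * weight S := by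
  simp [weight, Fin.prod_univ_succAbove _ k]

lemma sum_prod_sites {κ R : Type*} [Fintype κ] [CommSemiring R] {m : ℕ} (F : Fin m → κ → R) :
    ∑ T : Fin m → κ, ∏ i, F i (T i) = ∏ i, ∑ t, F i t := by
  classical
  rw [Finset.prod_univ_sum, Fintype.piFinset_univ]

lemma sum_weight (m : ℕ) : ∑ T : Fin m → Bool, weight T = 4 ^ m := by
  unfold weight
  rw [sum_prod_sites fun _ => siteWeight]
  norm_num [siteWeight]

/-- The weight restricted to nonempty supports. -/
noncomputable def neWeight {m : ℕ} (T : Fin m → Bool) : ℝ := if T = ⊥ then 0 else weight T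

lemma neWeight_nonneg {m : ℕ} (T : Fin m → Bool) : 0 ≤ neWeight T := by
  unfold neWeight; split_ifs
  exacts [le_rfl, (weight_pos T).le]

lemma sum_neWeight_mul {m : ℕ} (f : (Fin m → Bool) → ℝ) :
    ∑ T, neWeight T * f T = ∑ T, weight T * f T - f ⊥ := by
  have h : ∀ T : Fin m → Bool,
      neWeight T * f T = weight T * f T - if T = ⊥ then f ⊥ else 0 := by
    intro T
    by_cases hT : T = ⊥
    · subst hT; simp [neWeight, weight_bot]
    · simp [neWeight, hT]
  simp [h]

lemma sum_neWeight (m : ℕ) : ∑ T : Fin m → Bool, neWeight T = 4 ^ m - 1 := by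
  simpa [sum_weight] using sum_neWeight_mul (m := m) fun _ => 1

lemma insertNth_eq_bot_iff {m : ℕ} (k : Fin (m + 1)) (t : Bool) (S : Fin m → Bool) :
    k.insertNth (α := fun _ => Bool) t S = ⊥ ↔ t = false ∧ S = ⊥ := by
  rw [Fin.insertNth_eq_iff]
  simp only [funext_iff]
  rfl

/-- The support consisting of the single site `k`. -/
def single {m : ℕ} (k : Fin m) : Fin m → Bool := Function.update ⊥ k true

lemma insertNth_false_bot {m : ℕ} (k : Fin (m + 1)) :
    k.insertNth (α := fun _ => Bool) false ⊥ = ⊥ :=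
  (insertNth_eq_bot_iff k _ _).2 ⟨rfl, rfl⟩

lemma insertNth_true_bot {m : ℕ} (k : Fin (m + 1)) :
    k.insertNth (α := fun _ => Bool) true ⊥ = single k := by
  rw [single, ← insertNth_false_bot k, Fin.update_insertNth]

lemma single_succAbove {m : ℕ} (k : Fin (m + 1)) (l : Fin m) :
    single (k.succAbove l) = k.insertNth (α := fun _ => Bool) false (single l) := by
  rw [single, single, Fin.insertNth_update, insertNth_false_bot]

lemma insertNth_inj {m : ℕ} (k : Fin (m + 1)) {t t' : Bool} {S S' : Fin m → Bool} :
    k.insertNth (α := fun _ => Bool) t S = k.insertNth (α := fun _ => Bool) t' S' ↔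
      t = t' ∧ S = S' := by
  rw [Fin.insertNth_eq_iff]
  simp

lemma sum_neWeight_insertNth {m : ℕ} (k : Fin (m + 1)) (F : (Fin (m + 1) → Bool) → ℝ) :
    ∑ T, neWeight T * F T =
      ∑ S : Fin m → Bool, neWeight S * F (k.insertNth (α := fun _ => Bool) false S) +
      3 * (F (single k) +
        ∑ S : Fin m → Bool, neWeight S * F (k.insertNth (α := fun _ => Bool) true S)) := by
  rw [sum_neWeight_mul, sum_neWeight_mul, sum_neWeight_mul, sum_insertNth k]
  simp only [weight_insertNth, siteWeight, Fintype.sum_bool, mul_assoc, ← Finset.mul_sum,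
    if_true, Bool.false_eq_true, if_false, one_mul]
  rw [insertNth_true_bot, insertNth_false_bot]; ring

/-! ### Variances -/

/-- Variance (times the total mass) of `f` under the weight on nonempty supports. This is the
squared distance of `f` to the functions invariant under a Haar random gate on all sites. -/
noncomputable def supportVar {m : ℕ} (f : (Fin m → Bool) → ℝ) : ℝ :=
  ∑ T, neWeight T * f T ^ 2 - (∑ T, neWeight T * f T) ^ 2 / (4 ^ m - 1)

/-- `supportVar` for two sites, in terms of the values on the three nonempty supports. -/
noncomputable def varTwo (x y z : ℝ) : ℝ :=
  3 * x ^ 2 + 3 * y ^ 2 + 9 * z ^ 2 - (3 * x + 3 * y + 9 * z) ^ 2 / 15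

/-- The support `T` with its values at `c` and `d` replaced by `a` and `b`. -/
def setPair {m : ℕ} (c d : Fin m) (a b : Bool) (T : Fin m → Bool) : Fin m → Bool :=
  Function.update (Function.update T c a) d b

/-- The variance of `f` in the sites `c` and `d`, summed over the configurations of the other
sites (which are represented by the supports avoiding `c` and `d`). -/
noncomputable def pairVar {m : ℕ} (c d : Fin m) (f : (Fin m → Bool) → ℝ) : ℝ :=
  ∑ T, if T c = false ∧ T d = false then
    weight T * varTwo (f (setPair c d true false T)) (f (setPair c d false true T))
      (f (setPair c d true true T)) else 0

/-- The sum of `pairVar` over all ordered pairs of distinct sites. -/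
noncomputable def pairVarSum {m : ℕ} (f : (Fin m → Bool) → ℝ) : ℝ :=
  ∑ c, ∑ d, if c ≠ d then pairVar c d f else 0

lemma supportVar_shift {m : ℕ} (hm : m ≠ 0) {f h : (Fin m → Bool) → ℝ} {C : ℝ}
    (hf : ∀ T, T ≠ ⊥ → f T = h T + C) : supportVar f = supportVar h := by
  have h4 : (4 : ℝ) ^ m - 1 ≠ 0 := by
    have := one_lt_pow₀ (by norm_num : (1 : ℝ) < 4) hm
    linarith
  have h1 : ∑ T, neWeight T * f T = ∑ T, neWeight T * h T + (4 ^ m - 1) * C := by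
    rw [← sum_neWeight, Finset.sum_mul, ← Finset.sum_add_distrib]
    refine Finset.sum_congr rfl fun T _ => ?_
    by_cases hT : T = ⊥
    · simp [neWeight, hT]
    · rw [hf T hT]; ring
  have h2 : ∑ T, neWeight T * f T ^ 2 = ∑ T, neWeight T * h T ^ 2 +
      2 * C * ∑ T, neWeight T * h T + (4 ^ m - 1) * C ^ 2 := by
    rw [← sum_neWeight, Finset.sum_mul, Finset.mul_sum, ← Finset.sum_add_distrib,
      ← Finset.sum_add_distrib]
    refine Finset.sum_congr rfl fun T _ => ?_
    by_cases hT : T = ⊥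
    · simp [neWeight, hT]
    · rw [hf T hT]; ring
  unfold supportVar
  rw [h1, h2]
  field_simp
  ring

lemma setPair_insertNth {m : ℕ} (k : Fin (m + 1)) (t : Bool) (c d : Fin m) (a b : Bool)
    (S : Fin m → Bool) :
    setPair (k.succAbove c) (k.succAbove d) a b (k.insertNth (α := fun _ => Bool) t S) =
      k.insertNth (α := fun _ => Bool) t (setPair c d a b S) := by
  unfold setPair
  rw [Fin.insertNth_update, Fin.insertNth_update]

lemma pairVar_insertNth {m : ℕ} (k : Fin (m + 1)) (c d : Fin m) (f : (Fin (m + 1) → Bool) → ℝ) :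
    ∑ t, siteWeight t * pairVar c d (fun S => f (k.insertNth (α := fun _ => Bool) t S)) =
      pairVar (k.succAbove c) (k.succAbove d) f := by
  unfold pairVar
  rw [sum_insertNth k]
  refine Finset.sum_congr rfl fun t _ => ?_
  rw [Finset.mul_sum]
  refine Finset.sum_congr rfl fun S _ => ?_
  rw [Fin.insertNth_apply_succAbove, Fin.insertNth_apply_succAbove, mul_ite, mul_zero]
  simp only [setPair_insertNth, weight_insertNth, mul_assoc]

/-- Each pair of distinct sites survives the removal of `m - 1` of the `m + 1` sites. -/
lemma sum_pairVarSum_insertNth {m : ℕ} (f : (Fin (m + 1) → Bool) → ℝ) :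
    ∑ k : Fin (m + 1), ∑ t, siteWeight t *
        pairVarSum (fun S : Fin m → Bool => f (k.insertNth (α := fun _ => Bool) t S)) =
      ((m : ℝ) - 1) * pairVarSum f := by
  set G : Fin (m + 1) → Fin (m + 1) → ℝ := fun c d => if c ≠ d then pairVar c d f else 0 with hG
  have hk : ∀ k : Fin (m + 1), ∑ t, siteWeight t *
        pairVarSum (fun S : Fin m → Bool => f (k.insertNth (α := fun _ => Bool) t S)) =
      ∑ c, ∑ d, G c d - ∑ d, G k d - ∑ c, G c k := by
    intro k
    have h1 : ∑ t, siteWeight t *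
        pairVarSum (fun S : Fin m → Bool => f (k.insertNth (α := fun _ => Bool) t S)) =
        ∑ c, ∑ d, G (k.succAbove c) (k.succAbove d) := by
      unfold pairVarSum
      simp only [Finset.mul_sum]
      rw [Finset.sum_comm]
      refine Finset.sum_congr rfl fun c _ => ?_
      rw [Finset.sum_comm]
      refine Finset.sum_congr rfl fun d _ => ?_
      by_cases hcd : c = d
      · simp [hcd, hG]
      · simp only [hcd, ne_eq, not_false_iff, if_true, hG, Fin.succAbove_right_inj]
        exact pairVar_insertNth k c d f
    have hkk : G k k = 0 := by simp [hG]
    have h3 : ∀ c, ∑ d, G c d = G c k + ∑ d, G c (k.succAbove d) :=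
      fun c => Fin.sum_univ_succAbove _ k
    rw [h1, Fin.sum_univ_succAbove (fun c => ∑ d, G c d) k,
      Fin.sum_univ_succAbove (fun c => G c k) k, hkk]
    simp only [h3, Finset.sum_add_distrib]
    ring
  rw [Finset.sum_congr rfl fun k _ => hk k]
  rw [Finset.sum_sub_distrib, Finset.sum_sub_distrib, Finset.sum_comm (f := fun k c => G c k)]
  simp only [Finset.sum_const, Finset.card_univ, Fintype.card_fin, nsmul_eq_mul]
  simp only [pairVarSum]
  push_cast
  ring

/-! ### Almost orthogonality of the one-site-removed projections -/

lemma quadratic_form_nonneg {α β γ : ℝ} (hα : 0 < α) (h : β ^ 2 ≤ 4 * α * γ) (x y : ℝ) :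
    0 ≤ α * x ^ 2 + β * (x * y) + γ * y ^ 2 := by
  have : 0 ≤ 4 * α * (α * x ^ 2 + β * (x * y) + γ * y ^ 2) := by
    nlinarith [sq_nonneg (2 * α * x + β * y), mul_nonneg (sub_nonneg.2 h) (sq_nonneg y)]
  exact nonneg_of_mul_nonneg_right this (by positivity)

/-- With `σ = 4 ^ (m - 1)`, the bracket on the left is the inner product of the functions associated
by `profile` with two different sites (out of `m + 1`) and the same parameters, and the right-hand
side is the squared norm of either. The parameters are `(4 * σ - 1) * x`, `y` and `-x - y / 3`. -/
lemma gram_form_le {m σ : ℝ} (hm : 0 ≤ m) (hσ : 4 ≤ σ) (hmσ : m ^ 2 ≤ σ) (x y : ℝ) :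
    |m * (9 * σ * x ^ 2 + 24 * σ * (x * y) + y ^ 2)| ≤
      (4 * σ - 1) * (12 * σ * x ^ 2 + 2 * (x * y) + 4 / 3 * y ^ 2) := by
  have h2 : m ≤ σ := by nlinarith
  have key : 0 ≤ (σ - m ^ 2) * (576 * σ ^ 2 - 36 * σ) +
      4 * (16 * σ - 1) * ((σ - 1) * (7 * σ - 1)) := by
    have : 0 ≤ 576 * σ ^ 2 - 36 * σ := by nlinarith
    have h3 : 0 ≤ (σ - 1) * (7 * σ - 1) := mul_nonneg (by linarith) (by linarith)
    have h4 : (0 : ℝ) ≤ 16 * σ - 1 := by linarith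
    have h5 := sub_nonneg.2 hmσ
    positivity
  rw [abs_le]
  constructor
  · have := quadratic_form_nonneg (α := 12 * σ * (4 * σ - 1) + 9 * m * σ)
      (β := 2 * (4 * σ - 1) + 24 * m * σ) (γ := 4 / 3 * (4 * σ - 1) + m)
      (by nlinarith [mul_nonneg hm (by linarith : 0 ≤ σ)]) (by nlinarith) x y
    nlinarith
  · have := quadratic_form_nonneg (α := 12 * σ * (4 * σ - 1) - 9 * m * σ)
      (β := 2 * (4 * σ - 1) - 24 * m * σ) (γ := 4 / 3 * (4 * σ - 1) - m)
      (by nlinarith [mul_nonneg hm (by linarith : 0 ≤ σ)]) (by nlinarith) x y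
    nlinarith

/-- Polarized form of `gram_form_le`, in the unscaled parameters. The constraints say that the two
functions have mean zero. -/
lemma gram_le {m s a b c a' b' c' : ℝ} (hm : 0 ≤ m) (hs : 3 ≤ s) (hms : m ^ 2 ≤ s + 1)
    (h : 3 * a + (4 * s + 3) * b + 3 * (4 * s + 3) * c = 0)
    (h' : 3 * a' + (4 * s + 3) * b' + 3 * (4 * s + 3) * c' = 0) :
    2 * m * (b * (s * b' + 3 * (a' + s * c')) + 3 * (a * b' + c * (s * b' + 3 * (c' + s * c')))) ≤
      (3 * a ^ 2 + (4 * s + 3) * b ^ 2 + 3 * (4 * s + 3) * c ^ 2) +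
      (3 * a' ^ 2 + (4 * s + 3) * b' ^ 2 + 3 * (4 * s + 3) * c' ^ 2) := by
  obtain ⟨x, rfl⟩ : ∃ x, a = (4 * s + 3) * x := ⟨a / (4 * s + 3), by field_simp⟩
  obtain ⟨x', rfl⟩ : ∃ x, a' = (4 * s + 3) * x := ⟨a' / (4 * s + 3), by field_simp⟩
  have hM : 4 * s + 3 ≠ 0 := by linarith
  obtain rfl : c = -x - b / 3 := by
    refine mul_left_cancel₀ hM ?_
    linarith
  obtain rfl : c' = -x' - b' / 3 := by
    refine mul_left_cancel₀ hM ?_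
    linarith
  -- polarization: the form at the sum and at the difference
  have h1 := (abs_le.1 (gram_form_le hm (by linarith : 4 ≤ s + 1) hms (x + x') (b + b'))).2
  have h2 := (abs_le.1 (gram_form_le hm (by linarith : 4 ≤ s + 1) hms (x - x') (b - b'))).1
  nlinarith

/-- A function of a support `T ≠ ⊥` that only depends on `T k` and on whether `T` has other
sites than `k`. -/
def profile {m : ℕ} (k : Fin m) (a b c : ℝ) (T : Fin m → Bool) : ℝ :=
  if T k then (if T = single k then a else c) else b

lemma sum_neWeight_profile {m : ℕ} (l : Fin (m + 1)) (a b c : ℝ) :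
    ∑ T, neWeight T * profile l a b c T =
      (4 ^ m - 1) * b + 3 * (a + (4 ^ m - 1) * c) := by
  rw [sum_neWeight_insertNth l]
  unfold profile
  have h : ∀ S : Fin m → Bool,
      neWeight S * (if l.insertNth (α := fun _ => Bool) true S = single l then a else c) =
        neWeight S * c := by
    intro S
    simp only [← insertNth_true_bot, insertNth_inj]
    by_cases hS : S = ⊥ <;> simp [hS, neWeight]
  simp only [Fin.insertNth_apply_same, Bool.false_eq_true, if_false, if_true, h, ← Finset.sum_mul,
    sum_neWeight]
  simp [single]

lemma sum_neWeight_profile_mul_profile {m : ℕ} {k l : Fin (m + 2)} (hkl : k ≠ l)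
    (a b c a' b' c' : ℝ) :
    ∑ T, neWeight T * (profile k a b c T * profile l a' b' c' T) =
      b * ((4 ^ m - 1) * b' + 3 * (a' + (4 ^ m - 1) * c')) +
        3 * (a * b' + c * ((4 ^ m - 1) * b' + 3 * (c' + (4 ^ m - 1) * c'))) := by
  obtain ⟨l, rfl⟩ := Fin.exists_succAbove_eq hkl.symm
  have e1 : ∀ S : Fin (m + 1) → Bool,
      neWeight S * (profile k a b c (k.insertNth (α := fun _ => Bool) false S) *
        profile (k.succAbove l) a' b' c' (k.insertNth (α := fun _ => Bool) false S)) =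
      b * (neWeight S * profile l a' b' c' S) := by
    intro S
    have : k.insertNth (α := fun _ => Bool) false S = single (k.succAbove l) ↔ S = single l := by
      rw [single_succAbove, insertNth_inj]
      simp
    simp only [profile, Fin.insertNth_apply_same, Fin.insertNth_apply_succAbove, this,
      Bool.false_eq_true, if_false]
    ring
  have e2 : ∀ S : Fin (m + 1) → Bool,
      neWeight S * (profile k a b c (k.insertNth (α := fun _ => Bool) true S) *
        profile (k.succAbove l) a' b' c' (k.insertNth (α := fun _ => Bool) true S)) =
      c * (neWeight S * profile l c' b' c' S) := by
    intro S
    by_cases hS : S = ⊥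
    · simp [hS, neWeight]
    have h1 : k.insertNth (α := fun _ => Bool) true S ≠ single k := by
      rw [← insertNth_true_bot, Ne, insertNth_inj]
      simp [hS]
    have h2 : k.insertNth (α := fun _ => Bool) true S ≠ single (k.succAbove l) := by
      rw [single_succAbove, Ne, insertNth_inj]
      simp
    simp only [profile, Fin.insertNth_apply_same, Fin.insertNth_apply_succAbove, h1, h2,
      if_false, if_true, ite_self]
    ring
  have e3 : profile k a b c (single k) * profile (k.succAbove l) a' b' c' (single k) = a * b' := by
    simp [profile, single]
  rw [sum_neWeight_insertNth k, e3, Finset.sum_congr rfl fun S _ => e1 S,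
    Finset.sum_congr rfl fun S _ => e2 S, ← Finset.mul_sum, ← Finset.mul_sum,
    sum_neWeight_profile, sum_neWeight_profile]

/-- Removing one of `m + 1` sites, in all possible ways, increases the total variance by a factor
of at least `m - 1`. -/
lemma supportVar_le_sum_insertNth {m : ℕ} (f : (Fin (m + 3) → Bool) → ℝ) :
    ((m : ℝ) + 1) * supportVar f ≤ ∑ k : Fin (m + 3), ∑ t, siteWeight t *
      supportVar (fun S : Fin (m + 2) → Bool => f (k.insertNth (α := fun _ => Bool) t S)) := by
  set C : ℝ := (∑ T, neWeight T * f T) / (4 ^ (m + 3) - 1) with hC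
  set h : (Fin (m + 3) → Bool) → ℝ := fun T => f T - C with hh
  have hpow : (16 : ℝ) ≤ 4 ^ (m + 2) := by
    have := one_le_pow₀ (by norm_num : (1 : ℝ) ≤ 4) (n := m)
    rw [pow_add]; linarith
  have hpow3 : (4 : ℝ) ^ (m + 3) = 4 * 4 ^ (m + 2) := by ring
  have hf : supportVar f = supportVar h :=
    supportVar_shift (C := C) (by omega) fun T _ => by simp [hh]
  have hfk : ∀ (k : Fin (m + 3)) (t : Bool),
      supportVar (fun S : Fin (m + 2) → Bool => f (k.insertNth (α := fun _ => Bool) t S)) =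
      supportVar (fun S : Fin (m + 2) → Bool => h (k.insertNth (α := fun _ => Bool) t S)) :=
    fun k t => supportVar_shift (C := C) (by omega) fun T _ => by simp [hh]
  have hmean : ∑ T, neWeight T * h T = 0 := by
    simp only [hh, mul_sub, Finset.sum_sub_distrib, ← Finset.sum_mul, sum_neWeight, hC]
    rw [mul_div_cancel₀, sub_self]
    rw [hpow3]; linarith
  simp only [hf, hfk]
  clear_value h
  set M : ℝ := 4 ^ (m + 2) - 1 with hM
  have hM0 : 0 < M := by linarith
  set a : Fin (m + 3) → ℝ := fun k => h (single k) with ha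
  set b : Fin (m + 3) → ℝ := fun k =>
    (∑ S : Fin (m + 2) → Bool, neWeight S * h (k.insertNth (α := fun _ => Bool) false S)) / M
    with hb
  set c : Fin (m + 3) → ℝ := fun k =>
    (∑ S : Fin (m + 2) → Bool, neWeight S * h (k.insertNth (α := fun _ => Bool) true S)) / M
    with hc
  have hbM : ∀ k, ∑ S : Fin (m + 2) → Bool,
      neWeight S * h (k.insertNth (α := fun _ => Bool) false S) = M * b k := fun k => by
    rw [hb]; field_simp
  have hcM : ∀ k, ∑ S : Fin (m + 2) → Bool,
      neWeight S * h (k.insertNth (α := fun _ => Bool) true S) = M * c k := fun k => by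
    rw [hc]; field_simp
  clear_value b c
  set Q : Fin (m + 3) → ℝ := fun k => 3 * a k ^ 2 + M * b k ^ 2 + 3 * M * c k ^ 2 with hQ
  set w : Fin (m + 3) → (Fin (m + 3) → Bool) → ℝ := fun k => profile k (a k) (b k) (c k) with hw
  set H : ℝ := ∑ T, neWeight T * h T ^ 2 with hH
  have hzero : ∀ k, 3 * a k + M * b k + 3 * M * c k = 0 := by
    intro k
    have := sum_neWeight_insertNth k h
    rw [hmean, hbM, hcM] at this
    linarith
  have hVh : supportVar h = H := by
    unfold supportVar
    rw [hmean]; simp [hH]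
  have hV : ∀ k : Fin (m + 3), ∑ t, siteWeight t *
      supportVar (fun S : Fin (m + 2) → Bool => h (k.insertNth (α := fun _ => Bool) t S)) =
      H - Q k := by
    intro k
    have := sum_neWeight_insertNth k fun T => h T ^ 2
    simp only [supportVar, Fintype.sum_bool, siteWeight, if_true, Bool.false_eq_true, if_false,
      hbM, hcM, hH, this, hQ, ha]
    rw [← hM]
    field_simp
    ring
  -- `w k` is the projection of `h` to the functions invariant under gates avoiding the site `k`
  have hhw : ∀ k, ∑ T, neWeight T * (h T * w k T) = Q k := by
    intro k
    rw [sum_neWeight_insertNth k]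
    have e1 : ∀ S : Fin (m + 2) → Bool,
        neWeight S * (h (k.insertNth (α := fun _ => Bool) false S) *
          w k (k.insertNth (α := fun _ => Bool) false S)) =
        b k * (neWeight S * h (k.insertNth (α := fun _ => Bool) false S)) := by
      intro S
      simp only [hw, profile, Fin.insertNth_apply_same, Bool.false_eq_true, if_false]
      ring
    have e2 : ∀ S : Fin (m + 2) → Bool,
        neWeight S * (h (k.insertNth (α := fun _ => Bool) true S) *
          w k (k.insertNth (α := fun _ => Bool) true S)) =
        c k * (neWeight S * h (k.insertNth (α := fun _ => Bool) true S)) := by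
      intro S
      by_cases hS : S = ⊥
      · simp [hS, neWeight]
      simp only [hw, profile, Fin.insertNth_apply_same, if_true, ← insertNth_true_bot,
        insertNth_inj, hS, and_false, if_false]
      ring
    have e3 : w k (single k) = a k := by simp [hw, profile, single]
    rw [Finset.sum_congr rfl fun S _ => e1 S, Finset.sum_congr rfl fun S _ => e2 S,
      ← Finset.mul_sum, ← Finset.mul_sum, hbM, hcM, e3]
    simp only [hQ, ha]
    ring
  have hww : ∀ k, ∑ T, neWeight T * (w k T * w k T) = Q k := by
    intro k
    have : ∀ T, w k T * w k T = profile k (a k ^ 2) (b k ^ 2) (c k ^ 2) T := by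
      intro T
      simp only [hw, profile]
      split_ifs <;> ring
    simp only [this, sum_neWeight_profile, hQ]
    ring
  have hwl : ∀ k l, k ≠ l → 2 * ((m : ℝ) + 2) * ∑ T, neWeight T * (w k T * w l T) ≤ Q k + Q l := by
    intro k l hkl
    have e : M = 4 * (4 ^ (m + 1) - 1) + 3 := by rw [hM]; ring
    rw [sum_neWeight_profile_mul_profile hkl]
    simp only [hQ]
    have hz := hzero k
    have hz' := hzero l
    rw [e] at hz hz' ⊢
    refine gram_le (by positivity) (by linarith) ?_ hz hz'
    have h2 : m + 2 ≤ 2 ^ (m + 1) := Nat.lt_two_pow_self (n := m + 1)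
    have h3 : ((m : ℝ) + 2) ≤ 2 ^ (m + 1) := by exact_mod_cast h2
    calc ((m : ℝ) + 2) ^ 2 ≤ (2 ^ (m + 1)) ^ 2 := by gcongr
      _ = 4 ^ (m + 1) := by rw [← pow_mul, mul_comm, pow_mul]; norm_num
      _ = _ := by ring
  -- `‖∑ w k‖² ≤ 2 ∑ ‖w k‖²` implies `∑ ‖w k‖² ≤ 2 ‖h‖²`, since `⟨h, w k⟩ = ‖w k‖²`
  have hpos : 0 ≤ ∑ T, neWeight T * (2 * h T - ∑ k, w k T) ^ 2 :=
    Finset.sum_nonneg fun T _ => mul_nonneg (neWeight_nonneg T) (sq_nonneg _)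
  have hexp : ∑ T, neWeight T * (2 * h T - ∑ k, w k T) ^ 2 =
      4 * H - 4 * ∑ k, Q k + ∑ k, ∑ l, ∑ T, neWeight T * (w k T * w l T) := by
    have e1 : ∑ k, ∑ l, ∑ T, neWeight T * (w k T * w l T) =
        ∑ T, neWeight T * ((∑ k, w k T) * ∑ l, w l T) := by
      refine (Finset.sum_congr rfl fun l _ => Finset.sum_comm).trans ?_
      rw [Finset.sum_comm]
      refine Finset.sum_congr rfl fun T _ => ?_
      rw [Finset.sum_mul_sum]
      simp only [Finset.mul_sum]
    have e2 : ∑ k, Q k = ∑ T, neWeight T * (h T * ∑ k, w k T) := by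
      simp only [← hhw, Finset.mul_sum]
      rw [Finset.sum_comm]
    rw [e1, e2, hH, Finset.mul_sum, Finset.mul_sum, ← Finset.sum_sub_distrib,
      ← Finset.sum_add_distrib]
    exact Finset.sum_congr rfl fun T _ => by ring
  have hcross : 2 * ((m : ℝ) + 2) * ∑ k, ∑ l, ∑ T, neWeight T * (w k T * w l T) ≤
      4 * ((m : ℝ) + 2) * ∑ k, Q k := by
    have hle : ∀ k l, 2 * ((m : ℝ) + 2) * ∑ T, neWeight T * (w k T * w l T) ≤
        Q k + Q l + if k = l then 2 * ((m : ℝ) + 1) * Q k else 0 := by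
      intro k l
      by_cases hkl : k = l
      · subst hkl
        rw [hww, if_pos rfl]
        linarith
      · rw [if_neg hkl, add_zero]
        exact hwl k l hkl
    rw [Finset.mul_sum]
    simp only [Finset.mul_sum _ _ (2 * ((m : ℝ) + 2))] at hle ⊢
    refine (Finset.sum_le_sum fun k _ => Finset.sum_le_sum fun l _ => hle k l).trans_eq ?_
    simp only [Finset.sum_add_distrib, Finset.sum_const, Finset.card_univ, Fintype.card_fin,
      nsmul_eq_mul, Finset.sum_ite_eq, Finset.mem_univ, if_true, ← Finset.mul_sum]
    push_cast
    ring
  have hQH : ∑ k, Q k ≤ 2 * H := by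
    rw [hexp] at hpos
    have : ∑ k, ∑ l, ∑ T, neWeight T * (w k T * w l T) ≤ 2 * ∑ k, Q k := by
      refine le_of_mul_le_mul_left (hcross.trans_eq ?_) (by positivity : 0 < 2 * ((m : ℝ) + 2))
      ring
    linarith
  simp only [hV, hVh, Finset.sum_sub_distrib, Finset.sum_const, Finset.card_univ,
    Fintype.card_fin, nsmul_eq_mul]
  push_cast
  linarith

/-! ### The Poincaré inequality -/

lemma two_mul_supportVar_two (f : (Fin 2 → Bool) → ℝ) : 2 * supportVar f = pairVarSum f := by
  have hs : ∀ F : (Fin 2 → Bool) → ℝ,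
      ∑ T, F T = F ![true, true] + F ![true, false] + (F ![false, true] + F ![false, false]) := by
    intro F
    rw [← (finTwoArrowEquiv Bool).symm.sum_comp F, Fintype.sum_prod_type]
    simp [finTwoArrowEquiv]
  have hbot : (⊥ : Fin 2 → Bool) = ![false, false] := by decide
  have u1 : ∀ a b, setPair 0 1 a b ![false, false] = ![a, b] := by decide
  have u2 : ∀ a b, setPair 1 0 a b ![false, false] = ![b, a] := by decide
  have n1 : (![true, true] : Fin 2 → Bool) ≠ ![false, false] := by decide
  have n2 : (![true, false] : Fin 2 → Bool) ≠ ![false, false] := by decide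
  have n3 : (![false, true] : Fin 2 → Bool) ≠ ![false, false] := by decide
  simp only [supportVar, pairVarSum, pairVar, Fin.sum_univ_two, hs, neWeight, hbot, n1, n2, n3,
    weight, Fin.prod_univ_two, siteWeight]
  simp [u1, u2, varTwo]
  ring

/-- The spectral gap of the sum over all pairs of Haar random two-site gates is at least one (here
a factor two is present because pairs are ordered). -/
theorem two_mul_supportVar_le_pairVarSum (m : ℕ) (f : (Fin (m + 2) → Bool) → ℝ) :
    2 * supportVar f ≤ pairVarSum f := by
  induction m with
  | zero => exact (two_mul_supportVar_two f).le
  | succ m ih =>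
    have h1 := supportVar_le_sum_insertNth f
    have h2 := sum_pairVarSum_insertNth f
    have h3 : ∑ k : Fin (m + 3), ∑ t, siteWeight t * (2 *
        supportVar (fun S : Fin (m + 2) → Bool => f (k.insertNth (α := fun _ => Bool) t S))) ≤
        ∑ k : Fin (m + 3), ∑ t, siteWeight t *
        pairVarSum (fun S : Fin (m + 2) → Bool => f (k.insertNth (α := fun _ => Bool) t S)) :=
      Finset.sum_le_sum fun k _ => Finset.sum_le_sum fun t _ =>
        mul_le_mul_of_nonneg_left (ih _) (siteWeight_pos t).le
    rw [h2] at h3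
    simp only [mul_left_comm _ (2 : ℝ), ← Finset.mul_sum] at h3
    push_cast at h3
    refine le_of_mul_le_mul_left ?_ (by positivity : 0 < (m : ℝ) + 1)
    linarith

/-! ### Contraction of the averaged gate -/

lemma sum_split_site {m : ℕ} (c : Fin m) (F : (Fin m → Bool) → ℝ) :
    ∑ T, F T = ∑ T, if T c = false then F T + F (Function.update T c true) else 0 := by
  have hinv : Function.Involutive fun T : Fin m → Bool => Function.update T c (!T c) := by
    intro T; simp
  have h1 : ∑ T, (if T c = false then F (Function.update T c true) else 0) =
      ∑ T, if T c = true then F T else 0 := by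
    rw [← Equiv.sum_comp (hinv.toPerm _) fun T : Fin m → Bool => if T c = true then F T else 0]
    refine Finset.sum_congr rfl fun T _ => ?_
    simp only [Function.Involutive.coe_toPerm, Function.update_self]
    cases h : T c <;> simp
  have h2 : ∀ T : Fin m → Bool, (if T c = false then F T + F (Function.update T c true) else 0) =
      (if T c = false then F T else 0) +
        (if T c = false then F (Function.update T c true) else 0) := by
    intro T; split_ifs <;> simp
  simp only [h2]
  rw [Finset.sum_add_distrib, h1, ← Finset.sum_add_distrib]
  refine Finset.sum_congr rfl fun T _ => ?_
  cases h : T c <;> simp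

lemma weight_update_true {m : ℕ} {c : Fin m} {T : Fin m → Bool} (h : T c = false) :
    weight (Function.update T c true) = 3 * weight T := by
  unfold weight
  rw [← Finset.mul_prod_erase _ _ (Finset.mem_univ c),
    ← Finset.mul_prod_erase _ (fun i => siteWeight (T i)) (Finset.mem_univ c),
    Function.update_self, h]
  have : ∀ i ∈ Finset.univ.erase c, siteWeight (Function.update T c true i) = siteWeight (T i) := by
    intro i hi
    rw [Function.update_of_ne (Finset.ne_of_mem_erase hi)]
  rw [Finset.prod_congr rfl this]
  simp [siteWeight]

lemma sum_split_pair {m : ℕ} {c d : Fin m} (hcd : c ≠ d) (F : (Fin m → Bool) → ℝ) :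
    ∑ T, weight T * F T = ∑ T, if T c = false ∧ T d = false then
      weight T * (F T + 3 * F (setPair c d true false T) + 3 * F (setPair c d false true T) +
        9 * F (setPair c d true true T)) else 0 := by
  rw [sum_split_site c, sum_split_site d]
  refine Finset.sum_congr rfl fun T _ => ?_
  rw [Function.update_of_ne hcd]
  by_cases hd : T d = false
  · by_cases hc : T c = false
    · have e1 : Function.update T c false = T := Function.update_eq_self_iff.2 hc.symm
      have hd' : Function.update T c true d = false := by rwa [Function.update_of_ne hcd.symm]
      have e2 : Function.update (Function.update T c true) d false = Function.update T c true :=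
        Function.update_eq_self_iff.2 hd'.symm
      rw [if_pos hd, if_pos hc, if_pos hc, if_pos ⟨hc, hd⟩,
        Function.update_comm (β := fun _ => Bool) hcd.symm true true]
      simp only [setPair, e1, e2, weight_update_true hc, weight_update_true hd,
        weight_update_true hd']
      ring
    · simp [hc]
  · simp [hd]

/-- The Heisenberg evolution of functions of the support under one gate on `(c, d)`: a Haar random
one-qubit unitary on each of the two qubits, followed by a CNOT. -/
noncomputable def gateStep {m : ℕ} (c d : Fin m) (u : (Fin m → Bool) → ℝ) (T : Fin m → Bool) : ℝ :=
  if T c then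
    if T d then 2 / 9 * u (setPair c d true false T) + 2 / 9 * u (setPair c d false true T) +
      5 / 9 * u T
    else 1 / 3 * u T + 2 / 3 * u (setPair c d true true T)
  else if T d then 1 / 3 * u T + 2 / 3 * u (setPair c d true true T) else u T

lemma setPair_setPair {m : ℕ} {c d : Fin m} (hcd : c ≠ d) (a b a' b' : Bool) (T : Fin m → Bool) :
    setPair c d a b (setPair c d a' b' T) = setPair c d a b T := by
  unfold setPair
  rw [Function.update_comm (β := fun _ => Bool) hcd.symm b' a, Function.update_idem,
    Function.update_idem]

lemma setPair_fst {m : ℕ} {c d : Fin m} (hcd : c ≠ d) (a b : Bool) (T : Fin m → Bool) :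
    setPair c d a b T c = a := by
  simp [setPair, Function.update_of_ne hcd]

lemma setPair_snd {m : ℕ} (c d : Fin m) (a b : Bool) (T : Fin m → Bool) :
    setPair c d a b T d = b := by
  simp [setPair]

lemma gateStep_of_false {m : ℕ} {c d : Fin m} (u : (Fin m → Bool) → ℝ) {T : Fin m → Bool}
    (hc : T c = false) (hd : T d = false) : gateStep c d u T = u T := by
  simp [gateStep, hc, hd]

lemma gateStep_setPair {m : ℕ} {c d : Fin m} (hcd : c ≠ d) (u : (Fin m → Bool) → ℝ)
    (T : Fin m → Bool) :
    gateStep c d u (setPair c d true false T) =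
      1 / 3 * u (setPair c d true false T) + 2 / 3 * u (setPair c d true true T) ∧
    gateStep c d u (setPair c d false true T) =
      1 / 3 * u (setPair c d false true T) + 2 / 3 * u (setPair c d true true T) ∧
    gateStep c d u (setPair c d true true T) =
      2 / 9 * u (setPair c d true false T) + 2 / 9 * u (setPair c d false true T) +
        5 / 9 * u (setPair c d true true T) := by
  simp [gateStep, setPair_fst hcd, setPair_snd, setPair_setPair hcd]

lemma sum_weight_mul_gateStep {m : ℕ} {c d : Fin m} (hcd : c ≠ d) (u : (Fin m → Bool) → ℝ) :
    ∑ T, weight T * gateStep c d u T = ∑ T, weight T * u T := by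
  rw [sum_split_pair hcd, sum_split_pair hcd u]
  refine Finset.sum_congr rfl fun T _ => ?_
  split_ifs with h
  · obtain ⟨h1, h2, h3⟩ := gateStep_setPair hcd u T
    rw [h1, h2, h3, gateStep_of_false u h.1 h.2]
    ring
  · rfl

/-- On the functions orthogonal to the invariant ones, a gate has the eigenvalues `1 / 3` and
`-1 / 9`, whence the constant `8 / 9 = 1 - (1 / 3) ^ 2`. -/
lemma sum_weight_mul_gateStep_sq_le {m : ℕ} {c d : Fin m} (hcd : c ≠ d)
    (u : (Fin m → Bool) → ℝ) :
    ∑ T, weight T * gateStep c d u T ^ 2 ≤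
      ∑ T, weight T * u T ^ 2 - 8 / 9 * pairVar c d u := by
  rw [sum_split_pair hcd fun T => gateStep c d u T ^ 2, sum_split_pair hcd fun T => u T ^ 2,
    pairVar, Finset.mul_sum, ← Finset.sum_sub_distrib]
  refine Finset.sum_le_sum fun T _ => ?_
  split_ifs with h
  · obtain ⟨h1, h2, h3⟩ := gateStep_setPair hcd u T
    rw [h1, h2, h3, gateStep_of_false u h.1 h.2]
    generalize u (setPair c d true false T) = x
    generalize u (setPair c d false true T) = y
    generalize u (setPair c d true true T) = z
    have : 3 * (1 / 3 * x + 2 / 3 * z) ^ 2 + 3 * (1 / 3 * y + 2 / 3 * z) ^ 2 +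
        9 * (2 / 9 * x + 2 / 9 * y + 5 / 9 * z) ^ 2 ≤
        3 * x ^ 2 + 3 * y ^ 2 + 9 * z ^ 2 - 8 / 9 * varTwo x y z := by
      unfold varTwo
      nlinarith [sq_nonneg (x + y - 2 * z), sq_nonneg (x - y)]
    have := mul_le_mul_of_nonneg_left this (weight_pos T).le
    linarith
  · simp

/-- The average of `gateStep` over all ordered pairs of distinct qubits. -/
noncomputable def avgStep {m : ℕ} (u : (Fin m → Bool) → ℝ) (T : Fin m → Bool) : ℝ :=
  (∑ p : QubitPair m, gateStep p.1.1 p.1.2 u T) / (m * (m - 1))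

lemma sum_qubitPair {M : Type*} [AddCommMonoid M] {m : ℕ} (F : Fin m → Fin m → M) :
    ∑ p : QubitPair m, F p.1.1 p.1.2 = ∑ c, ∑ d, if c ≠ d then F c d else 0 := by
  rw [← Fintype.sum_prod_type' fun c d => if c ≠ d then F c d else 0, ← Finset.sum_filter]
  exact (Finset.sum_subtype (Finset.univ.filter fun p : Fin m × Fin m => p.1 ≠ p.2) (by simp)
    fun p => F p.1 p.2).symm

lemma card_qubitPair (m : ℕ) : (Fintype.card (QubitPair m) : ℝ) = m * (m - 1) := by
  have h := sum_qubitPair (m := m) fun _ _ => (1 : ℝ)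
  have h1 : ∀ c d : Fin m, (if c ≠ d then (1 : ℝ) else 0) = 1 - if c = d then 1 else 0 := by
    intro c d; by_cases h : c = d <;> simp [h]
  simp only [h1, Finset.sum_sub_distrib] at h
  rw [mul_sub_one]
  simpa using h

lemma avgStep_bot {m : ℕ} (hm : 2 ≤ m) (u : (Fin m → Bool) → ℝ) : avgStep u ⊥ = u ⊥ := by
  have h2 : (2 : ℝ) ≤ m := by exact_mod_cast hm
  have : ∀ p : QubitPair m, gateStep p.1.1 p.1.2 u ⊥ = u ⊥ := fun p => gateStep_of_false u rfl rfl
  unfold avgStep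
  simp only [this, Finset.sum_const, Finset.card_univ, nsmul_eq_mul, card_qubitPair]
  have h3 : (m : ℝ) - 1 ≠ 0 := by linarith
  field_simp

lemma sum_weight_mul_avgStep {m : ℕ} (hm : 2 ≤ m) (u : (Fin m → Bool) → ℝ) :
    ∑ T, weight T * avgStep u T = ∑ T, weight T * u T := by
  have h2 : (2 : ℝ) ≤ m := by exact_mod_cast hm
  have h3 : (m : ℝ) - 1 ≠ 0 := by linarith
  unfold avgStep
  simp only [mul_div_assoc', Finset.mul_sum, ← Finset.sum_div]
  rw [Finset.sum_comm]
  have : ∀ p : QubitPair m, ∑ T, weight T * gateStep p.1.1 p.1.2 u T = ∑ T, weight T * u T :=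
    fun p => sum_weight_mul_gateStep p.2 u
  simp only [this, Finset.sum_const, Finset.card_univ, nsmul_eq_mul, card_qubitPair]
  field_simp

/-- Contraction of one random step on the functions orthogonal to the stationary ones. -/
theorem sum_weight_mul_avgStep_sq_le {m : ℕ} (hm : 2 ≤ m) {u : (Fin m → Bool) → ℝ}
    (h0 : u ⊥ = 0) (hu : ∑ T, weight T * u T = 0) :
    ∑ T, weight T * avgStep u T ^ 2 ≤
      (1 - 16 / (9 * m * (m - 1))) * ∑ T, weight T * u T ^ 2 := by
  have h2 : (2 : ℝ) ≤ m := by exact_mod_cast hm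
  have h3 : 0 < (m : ℝ) - 1 := by linarith
  have hK : 0 < (m : ℝ) * (m - 1) := by positivity
  have hvar : supportVar u = ∑ T, weight T * u T ^ 2 := by
    simp only [supportVar, sum_neWeight_mul u, sum_neWeight_mul fun T => u T ^ 2, h0, hu]
    simp
  have hgap : 2 * supportVar u ≤ pairVarSum u := by
    obtain ⟨k, rfl⟩ := Nat.exists_eq_add_of_le' hm
    exact two_mul_supportVar_le_pairVarSum k u
  have hpairs : pairVarSum u = ∑ p : QubitPair m, pairVar p.1.1 p.1.2 u :=
    (sum_qubitPair fun c d => pairVar c d u).symm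
  have hjensen : ∀ T, avgStep u T ^ 2 ≤
      (∑ p : QubitPair m, gateStep p.1.1 p.1.2 u T ^ 2) / (m * (m - 1)) := by
    intro T
    have := sq_sum_le_card_mul_sum_sq (s := (Finset.univ : Finset (QubitPair m)))
      (f := fun p => gateStep p.1.1 p.1.2 u T)
    rw [Finset.card_univ, card_qubitPair] at this
    rw [avgStep, div_pow, div_le_div_iff₀ (by positivity) hK]
    nlinarith
  calc ∑ T, weight T * avgStep u T ^ 2
      ≤ ∑ T, weight T * ((∑ p : QubitPair m, gateStep p.1.1 p.1.2 u T ^ 2) / (m * (m - 1))) :=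
        Finset.sum_le_sum fun T _ => mul_le_mul_of_nonneg_left (hjensen T) (weight_pos T).le
    _ = (∑ p : QubitPair m, ∑ T, weight T * gateStep p.1.1 p.1.2 u T ^ 2) / (m * (m - 1)) := by
        simp only [mul_div_assoc', Finset.mul_sum, ← Finset.sum_div]
        rw [Finset.sum_comm]
    _ ≤ (∑ p : QubitPair m, (∑ T, weight T * u T ^ 2 - 8 / 9 * pairVar p.1.1 p.1.2 u)) /
          (m * (m - 1)) := by
        gcongr with p
        exact sum_weight_mul_gateStep_sq_le p.2 u
    _ = ∑ T, weight T * u T ^ 2 - 8 / 9 * pairVarSum u / (m * (m - 1)) := by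
        rw [Finset.sum_sub_distrib, ← Finset.mul_sum, ← hpairs]
        simp only [Finset.sum_const, Finset.card_univ, nsmul_eq_mul, card_qubitPair]
        field_simp
    _ ≤ ∑ T, weight T * u T ^ 2 - 8 / 9 * (2 * supportVar u) / (m * (m - 1)) := by
        gcongr
    _ = _ := by
        rw [hvar]
        field_simp
        ring

/-! ### Convergence to the stationary profile -/

/-- The Haar average over all `N`-qubit states of the squared Pauli expectation values. -/
noncomputable def stationary {m : ℕ} (T : Fin m → Bool) : ℝ :=
  if T = ⊥ then 1 else 1 / (2 ^ m + 1)

lemma gateStep_stationary {m : ℕ} {c d : Fin m} (hcd : c ≠ d) :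
    gateStep c d stationary = (stationary : (Fin m → Bool) → ℝ) := by
  funext T
  have hne : ∀ {S : Fin m → Bool} (i : Fin m), S i = true → S ≠ ⊥ := by
    rintro S i h rfl
    simp at h
  have n11 : setPair c d true true T ≠ ⊥ := hne d (setPair_snd c d _ _ T)
  have n01 : setPair c d false true T ≠ ⊥ := hne d (setPair_snd c d _ _ T)
  unfold gateStep
  by_cases hc : T c = true
  · have hT := hne c hc
    by_cases hd : T d = true
    · have n10 : setPair c d true false T ≠ ⊥ := hne c (setPair_fst hcd _ _ T)
      simp only [hc, hd, if_true, stationary, hT, n10, n01, if_false]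
      ring
    · simp only [hc, hd, if_true, stationary, hT, n11, if_false, Bool.false_eq_true]
      ring
  · by_cases hd : T d = true
    · simp only [hc, hd, if_true, stationary, hne d hd, n11, if_false, Bool.false_eq_true]
      ring
    · simp [hc, hd]

lemma avgStep_sub_stationary {m : ℕ} (hm : 2 ≤ m) (s : (Fin m → Bool) → ℝ) :
    avgStep s - stationary = avgStep (s - stationary) := by
  have h2 : (2 : ℝ) ≤ m := by exact_mod_cast hm
  have h3 : (m : ℝ) - 1 ≠ 0 := by linarith
  have hsub : ∀ (c d : Fin m), gateStep c d (s - stationary) =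
      gateStep c d s - gateStep c d stationary := by
    intro c d
    funext T
    simp only [gateStep, Pi.sub_apply]
    split_ifs <;> ring
  have hst : ∀ p : QubitPair m, gateStep p.1.1 p.1.2 (stationary : (Fin m → Bool) → ℝ) =
      stationary := fun p => gateStep_stationary p.2
  funext T
  simp only [avgStep, hsub, hst, Pi.sub_apply, Finset.sum_sub_distrib,
    Finset.sum_const, Finset.card_univ, nsmul_eq_mul, card_qubitPair]
  field_simp

lemma sum_weight_mul_stationary (m : ℕ) :
    ∑ T : Fin m → Bool, weight T * stationary T = 2 ^ m := by
  have h : ∀ T : Fin m → Bool, weight T * stationary T =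
      (weight T * (1 / (2 ^ m + 1)) + if T = ⊥ then 1 - 1 / (2 ^ m + 1) else 0) := by
    intro T
    by_cases hT : T = ⊥
    · simp [hT, stationary, weight_bot]
    · simp [hT, stationary]
  have h4 : (4 : ℝ) ^ m = 2 ^ m * 2 ^ m := by rw [← mul_pow]; norm_num
  simp only [h, Finset.sum_add_distrib, ← Finset.sum_mul, sum_weight, Finset.sum_ite_eq',
    Finset.mem_univ, if_true]
  rw [h4]
  field_simp
  ring

theorem sum_weight_mul_sub_stationary_sq_le {m : ℕ} (hm : 2 ≤ m) {s : ℕ → (Fin m → Bool) → ℝ}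
    (hs : ∀ n, s (n + 1) = avgStep (s n)) (hbot : s 0 ⊥ = 1)
    (hsum : ∑ T, weight T * s 0 T = 2 ^ m) (hle : ∀ T, |s 0 T| ≤ 1) (n : ℕ) :
    ∑ T, weight T * (s n T - stationary T) ^ 2 ≤
      4 * 4 ^ m * Real.exp (-(16 * n / (9 * m * (m - 1)))) := by
  have h2 : (2 : ℝ) ≤ m := by exact_mod_cast hm
  have h3 : 0 < (m : ℝ) - 1 := by linarith
  have inv : ∀ n, (s n - stationary : (Fin m → Bool) → ℝ) ⊥ = 0 ∧
      ∑ T, weight T * (s n - stationary : (Fin m → Bool) → ℝ) T = 0 := by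
    intro n
    induction n with
    | zero =>
      refine ⟨by simp [hbot, stationary], ?_⟩
      simp only [Pi.sub_apply, mul_sub, Finset.sum_sub_distrib, hsum, sum_weight_mul_stationary,
        sub_self]
    | succ n ih =>
      rw [hs, avgStep_sub_stationary hm, avgStep_bot hm, sum_weight_mul_avgStep hm]
      exact ih
  induction n with
  | zero =>
    have h1 : ∀ T : Fin m → Bool, (s 0 T - stationary T) ^ 2 ≤ 4 := by
      intro T
      have hs1 : 0 ≤ (stationary T : ℝ) ∧ stationary T ≤ (1 : ℝ) := by
        unfold stationary
        split_ifs
        · simp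
        · refine ⟨by positivity, ?_⟩
          rw [div_le_one (by positivity)]
          have : (0 : ℝ) < 2 ^ m := by positivity
          linarith
      have := abs_le.1 (hle T)
      have h := abs_le.2 (⟨by linarith, by linarith⟩ :
        -2 ≤ s 0 T - stationary T ∧ s 0 T - stationary T ≤ 2)
      calc (s 0 T - stationary T) ^ 2 = |s 0 T - stationary T| ^ 2 := (sq_abs _).symm
        _ ≤ 2 ^ 2 := by gcongr
        _ = 4 := by norm_num
    calc ∑ T, weight T * (s 0 T - stationary T) ^ 2 ≤ ∑ T : Fin m → Bool, weight T * 4 :=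
          Finset.sum_le_sum fun T _ => mul_le_mul_of_nonneg_left (h1 T) (weight_pos T).le
      _ = 4 * 4 ^ m := by rw [← Finset.sum_mul, sum_weight]; ring
      _ = _ := by simp
  | succ n ih =>
    have hcon := sum_weight_mul_avgStep_sq_le hm (inv n).1 (inv n).2
    rw [← avgStep_sub_stationary hm, ← hs] at hcon
    refine hcon.trans ?_
    have hnn : 0 ≤ ∑ T, weight T * (s n T - stationary T) ^ 2 :=
      Finset.sum_nonneg fun T _ => mul_nonneg (weight_pos T).le (sq_nonneg _)
    have he : 1 - 16 / (9 * (m : ℝ) * (m - 1)) ≤ Real.exp (-(16 / (9 * m * (m - 1)))) := by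
      have := Real.add_one_le_exp (-(16 / (9 * (m : ℝ) * (m - 1))))
      linarith
    calc (1 - 16 / (9 * (m : ℝ) * (m - 1))) * ∑ T, weight T * (s n T - stationary T) ^ 2
        ≤ Real.exp (-(16 / (9 * m * (m - 1)))) *
          (4 * 4 ^ m * Real.exp (-(16 * n / (9 * m * (m - 1))))) :=
          mul_le_mul he ih hnn (Real.exp_pos _).le
      _ = 4 * 4 ^ m * Real.exp (-(16 * (n + 1 : ℕ) / (9 * m * (m - 1)))) := by
          rw [mul_left_comm, ← Real.exp_add]
          congr 2
          push_cast
          ring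

/-! ### Product observables on two copies of the state -/

/-- Row indices and column indices of a one-qubit operator on two copies of the qubit. -/
abbrev Quad : Type := (Fin 2 × Fin 2) × (Fin 2 × Fin 2)

/-- The entries of `|ψ⟩⟨ψ| ⊗ |ψ⟩⟨ψ|`, with the four indices of each qubit grouped together. -/
def amp {N : ℕ} (ψ : Bits N → ℂ) (z : Fin N → Quad) : ℂ :=
  star (ψ fun i => (z i).1.1) * star (ψ fun i => (z i).1.2) * ψ (fun i => (z i).2.1) *
    ψ fun i => (z i).2.2

/-- The expectation in `ψ ⊗ ψ` of the tensor product over the qubits of the two-copy operators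
`O i`. -/
def expect {N : ℕ} (O : Fin N → Quad → ℂ) (ψ : Bits N → ℂ) : ℂ :=
  ∑ z : Fin N → Quad, amp ψ z * ∏ i, O i (z i)

lemma expect_update {N : ℕ} (O : Fin N → Quad → ℂ) (c : Fin N) (a : Quad → ℂ) (ψ : Bits N → ℂ) :
    expect (Function.update O c a) ψ =
      ∑ z : Fin N → Quad, amp ψ z * (a (z c) * ∏ i ∈ Finset.univ.erase c, O i (z i)) := by
  unfold expect
  refine Finset.sum_congr rfl fun z _ => ?_
  rw [← Finset.mul_prod_erase _ _ (Finset.mem_univ c), Function.update_self]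
  congr 2
  refine Finset.prod_congr rfl fun i hi => ?_
  rw [Function.update_of_ne (Finset.ne_of_mem_erase hi)]

lemma expect_update_sum {N : ℕ} {J : Type*} (s : Finset J) (O : Fin N → Quad → ℂ) (c : Fin N)
    (k : J → ℂ) (a : J → Quad → ℂ) (ψ : Bits N → ℂ) :
    expect (Function.update O c fun z => ∑ j ∈ s, k j * a j z) ψ =
      ∑ j ∈ s, k j * expect (Function.update O c (a j)) ψ := by
  simp only [expect_update, Finset.mul_sum, Finset.sum_mul]
  rw [Finset.sum_comm]
  refine Finset.sum_congr rfl fun j _ => Finset.sum_congr rfl fun z _ => ?_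
  ring

lemma amp_norm_le {N : ℕ} {ψ : Bits N → ℂ} {R : ℝ} (h : ∀ x, ‖ψ x‖ ≤ R) (z : Fin N → Quad) :
    ‖amp ψ z‖ ≤ R ^ 4 := by
  have hR : 0 ≤ R := (norm_nonneg _).trans (h fun _ => 0)
  simp only [amp, norm_mul, norm_star]
  calc _ ≤ R * R * R * R := by gcongr <;> apply h
    _ = R ^ 4 := by ring

/-- The entries of `Z ^ q * X ^ p`, which is a Pauli matrix up to a phase. -/
def pauliEntry (p q x y : Fin 2) : ℤ := if x + y = p then (-1) ^ (q.val * x.val) else 0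

/-- The operator `σ ⊗ σ` on two copies of a qubit, where `σ` is the Pauli matrix with `X`-exponent
`p` and `Z`-exponent `q`. The sign accounts for `Y` being `Z X`
up to a factor `±i`. -/
def pauliSq (p q : Fin 2) (z : Quad) : ℂ :=
  ((-1 : ℤ) ^ (p.val * q.val) * pauliEntry p q z.1.1 z.2.1 * pauliEntry p q z.1.2 z.2.2 : ℤ)

/-- The operator exchanging the two copies of a qubit. -/
def swapOp (z : Quad) : ℂ := if z.1 = z.2.swap then 1 else 0

/-- The average of `X ⊗ X`, `Y ⊗ Y` and `Z ⊗ Z`. -/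
noncomputable def pauliAvg (z : Quad) : ℂ :=
  1 / 3 * (pauliSq 0 1 z + pauliSq 1 0 z + pauliSq 1 1 z)

lemma pauliSq_zero (z : Quad) : pauliSq 0 0 z = if z.1 = z.2 then 1 else 0 := by
  have h : ∀ z : Quad, ((-1 : ℤ) ^ ((0 : Fin 2).val * (0 : Fin 2).val) *
      pauliEntry 0 0 z.1.1 z.2.1 * pauliEntry 0 0 z.1.2 z.2.2 : ℤ) =
      if z.1 = z.2 then 1 else 0 := by decide
  rw [pauliSq, h]
  split_ifs <;> simp

lemma swapOp_eq (z : Quad) : swapOp z = 1 / 2 * pauliSq 0 0 z + 3 / 2 * pauliAvg z := by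
  have h : ∀ z : Quad,
      ((-1 : ℤ) ^ ((0 : Fin 2).val * (0 : Fin 2).val) * pauliEntry 0 0 z.1.1 z.2.1 *
        pauliEntry 0 0 z.1.2 z.2.2) +
      ((-1 : ℤ) ^ ((0 : Fin 2).val * (1 : Fin 2).val) * pauliEntry 0 1 z.1.1 z.2.1 *
        pauliEntry 0 1 z.1.2 z.2.2) +
      ((-1 : ℤ) ^ ((1 : Fin 2).val * (0 : Fin 2).val) * pauliEntry 1 0 z.1.1 z.2.1 *
        pauliEntry 1 0 z.1.2 z.2.2) +
      ((-1 : ℤ) ^ ((1 : Fin 2).val * (1 : Fin 2).val) * pauliEntry 1 1 z.1.1 z.2.1 *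
        pauliEntry 1 1 z.1.2 z.2.2) = 2 * if z.1 = z.2.swap then 1 else 0 := by decide
  have h1 := congrArg (Int.cast : ℤ → ℂ) (h z)
  rw [Int.cast_add, Int.cast_add, Int.cast_add] at h1
  change pauliSq 0 0 z + pauliSq 0 1 z + pauliSq 1 0 z + pauliSq 1 1 z = _ at h1
  rw [swapOp, pauliAvg]
  push_cast at h1
  linear_combination (-1 / 2) * h1

/-! ### The CNOT gate permutes the Pauli operators -/

lemma cnot_mulVec {N : ℕ} {c d : Fin N} (hcd : c ≠ d) (φ : Bits N → ℂ) (x : Bits N) :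
    (cnot c d).mulVec φ x = φ (Function.update x d (x d + x c)) := by
  have h2 : ∀ a b : Fin 2, a + b + b = a := by decide
  have h : ∀ y : Bits N, x = Function.update y d (y d + y c) ↔
      y = Function.update x d (x d + x c) := by
    intro y
    constructor
    · rintro rfl
      simp [Function.update_of_ne hcd, h2]
    · rintro rfl
      simp [Function.update_of_ne hcd, h2]
  simp [Matrix.mulVec, dotProduct, cnot, h]

lemma amp_cnot {N : ℕ} {c d : Fin N} (hcd : c ≠ d) (φ : Bits N → ℂ) (z : Fin N → Quad) :
    amp ((cnot c d).mulVec φ) z = amp φ (Function.update z d (z d + z c)) := by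
  have h : ∀ π : Quad → Fin 2, (∀ a b, π (a + b) = π a + π b) →
      (Function.update (fun i => π (z i)) d (π (z d) + π (z c))) =
        fun i => π (Function.update z d (z d + z c) i) := by
    intro π hπ
    funext i
    by_cases hi : i = d
    · subst hi; simp [hπ]
    · simp [Function.update_of_ne hi]
  simp only [amp, cnot_mulVec hcd]
  rw [h (fun w => w.1.1) (fun _ _ => rfl), h (fun w => w.1.2) (fun _ _ => rfl),
    h (fun w => w.2.1) (fun _ _ => rfl), h (fun w => w.2.2) (fun _ _ => rfl)]

/-- Conjugation by CNOT copies `X` from the control to the target and `Z` from the target to the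
control; the signs cancel because each Pauli operator occurs twice. -/
lemma pauliSq_mul_pauliSq_add (p q r s : Fin 2) (z w : Quad) :
    pauliSq p q z * pauliSq r s (w + z) = pauliSq p (q + s) z * pauliSq (r + p) s w := by
  have h : ∀ p q r s x y u v : Fin 2,
      pauliEntry p q x y * pauliEntry r s (u + x) (v + y) =
        pauliEntry p (q + s) x y * pauliEntry (r + p) s u v := by decide
  have hs : ∀ p q r s : Fin 2, (-1 : ℤ) ^ (p.val * q.val) * (-1 : ℤ) ^ (r.val * s.val) =
      (-1 : ℤ) ^ (p.val * (q + s).val) * (-1 : ℤ) ^ ((r + p).val * s.val) := by decide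
  unfold pauliSq
  rw [← Int.cast_mul, ← Int.cast_mul]
  congr 1
  have h1 := h p q r s z.1.1 z.2.1 w.1.1 w.2.1
  have h2 := h p q r s z.1.2 z.2.2 w.1.2 w.2.2
  have h3 := hs p q r s
  simp only [Prod.fst_add, Prod.snd_add]
  generalize pauliEntry p q z.1.1 z.2.1 = a1 at *
  generalize pauliEntry p q z.1.2 z.2.2 = a2 at *
  generalize pauliEntry r s (w.1.1 + z.1.1) (w.2.1 + z.2.1) = b1 at *
  generalize pauliEntry r s (w.1.2 + z.1.2) (w.2.2 + z.2.2) = b2 at *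
  generalize pauliEntry p (q + s) z.1.1 z.2.1 = a3 at *
  generalize pauliEntry p (q + s) z.1.2 z.2.2 = a4 at *
  generalize pauliEntry (r + p) s w.1.1 w.2.1 = b3 at *
  generalize pauliEntry (r + p) s w.1.2 w.2.2 = b4 at *
  calc _ = ((-1 : ℤ) ^ (p.val * q.val) * (-1 : ℤ) ^ (r.val * s.val)) * (a1 * b1) * (a2 * b2) := by
        ring
    _ = _ := by rw [h1, h2, h3]; ring

lemma expect_cnot {N : ℕ} {c d : Fin N} (hcd : c ≠ d) (O : Fin N → Quad → ℂ) (p q r s : Fin 2)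
    (φ : Bits N → ℂ) :
    expect (Function.update (Function.update O c (pauliSq p q)) d (pauliSq r s))
        ((cnot c d).mulVec φ) =
      expect (Function.update (Function.update O c (pauliSq p (q + s))) d (pauliSq (r + p) s))
        φ := by
  have h2 : ∀ a b : Quad, a + b + b = a := by decide
  have hinv : Function.Involutive fun z : Fin N → Quad => Function.update z d (z d + z c) := by
    intro z
    simp [Function.update_of_ne hcd, h2]
  have hc : c ∈ Finset.univ.erase d := Finset.mem_erase.2 ⟨hcd, Finset.mem_univ c⟩
  have hprod : ∀ (a : Quad → ℂ) (z : Fin N → Quad),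
      ∏ i ∈ Finset.univ.erase d, Function.update O c a i (z i) =
        a (z c) * ∏ i ∈ (Finset.univ.erase d).erase c, O i (z i) := by
    intro a z
    rw [← Finset.mul_prod_erase _ _ hc, Function.update_self]
    congr 1
    refine Finset.prod_congr rfl fun i hi => ?_
    rw [Function.update_of_ne (Finset.ne_of_mem_erase hi)]
  rw [expect_update, expect_update]
  rw [← Equiv.sum_comp (hinv.toPerm _)]
  refine Finset.sum_congr rfl fun z _ => ?_
  simp only [hprod, Function.Involutive.coe_toPerm, amp_cnot hcd]
  have e1 : Function.update (Function.update z d (z d + z c)) d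
      (Function.update z d (z d + z c) d + Function.update z d (z d + z c) c) = z := hinv z
  have e2 : ∏ i ∈ (Finset.univ.erase d).erase c, O i (Function.update z d (z d + z c) i) =
      ∏ i ∈ (Finset.univ.erase d).erase c, O i (z i) := by
    refine Finset.prod_congr rfl fun i hi => ?_
    rw [Function.update_of_ne (Finset.ne_of_mem_erase (Finset.mem_of_mem_erase hi))]
  rw [e1, e2, Function.update_self, Function.update_of_ne hcd, ← mul_assoc (pauliSq r s _),
    mul_comm (pauliSq r s _), pauliSq_mul_pauliSq_add]
  ring

/-! ### One-qubit unitaries -/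

lemma onQubit_mulVec {N : ℕ} (c : Fin N) (U : Matrix (Fin 2) (Fin 2) ℂ) (ψ : Bits N → ℂ)
    (x : Bits N) :
    (onQubit c U).mulVec ψ x = ∑ t, U (x c) t * ψ (Function.update x c t) := by
  have hinj : Function.Injective fun t => Function.update x c t := Function.update_injective x c
  rw [Matrix.mulVec, dotProduct]
  have h := Finset.sum_map (Finset.univ : Finset (Fin 2)) ⟨_, hinj⟩
    fun y : Bits N => onQubit c U x y * ψ y
  rw [← Finset.sum_subset (Finset.subset_univ (Finset.univ.map ⟨_, hinj⟩)), h]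
  · refine Finset.sum_congr rfl fun t _ => ?_
    have : ∀ i, i ≠ c → x i = Function.update x c t i := fun i hi => by
      rw [Function.update_of_ne hi]
    simp only [Function.Embedding.coeFn_mk, onQubit]
    rw [if_pos this, Function.update_self]
  · intro y _ hy
    rw [onQubit, if_neg, zero_mul]
    intro hxy
    refine hy (Finset.mem_map.2 ⟨y c, Finset.mem_univ _, ?_⟩)
    funext i
    by_cases hi : i = c
    · subst hi; simp
    · simp [Function.update_of_ne hi, hxy i hi]

lemma onQubit_mul_mulVec {N : ℕ} (c : Fin N) (U V : Matrix (Fin 2) (Fin 2) ℂ) (ψ : Bits N → ℂ) :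
    (onQubit c (U * V)).mulVec ψ = (onQubit c U).mulVec ((onQubit c V).mulVec ψ) := by
  funext x
  simp only [onQubit_mulVec, Matrix.mul_apply, Function.update_self, Function.update_idem,
    Finset.sum_mul, Finset.mul_sum]
  rw [Finset.sum_comm]
  simp only [mul_assoc]

/-- The coefficient with which the `z` entry of a two-copy operator enters the `w` entry of its
conjugate `(U ⊗ U)⁻¹ a (U ⊗ U)`. -/
def conjKernel (U : Matrix (Fin 2) (Fin 2) ℂ) (z w : Quad) : ℂ :=
  star (U z.1.1 w.1.1) * star (U z.1.2 w.1.2) * U z.2.1 w.2.1 * U z.2.2 w.2.2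

/-- Conjugation of a two-copy operator `a` by `U`, that is, `(U ⊗ U)⁻¹ a (U ⊗ U)`. -/
def conjOp (U : Matrix (Fin 2) (Fin 2) ℂ) (a : Quad → ℂ) (z : Quad) : ℂ :=
  ∑ w, a w * conjKernel U w z

lemma amp_onQubit {N : ℕ} (c : Fin N) (U : Matrix (Fin 2) (Fin 2) ℂ) (ψ : Bits N → ℂ)
    (z : Fin N → Quad) :
    amp ((onQubit c U).mulVec ψ) z =
      ∑ w, conjKernel U (z c) w * amp ψ (Function.update z c w) := by
  have h : ∀ (π : Quad → Fin 2) (w : Quad), (fun i => π (Function.update z c w i)) =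
      Function.update (fun i => π (z i)) c (π w) := by
    intro π w
    funext i
    by_cases hi : i = c
    · subst hi; simp
    · simp [Function.update_of_ne hi]
  simp only [amp, onQubit_mulVec, conjKernel, Fintype.sum_prod_type]
  simp only [h fun w => w.1.1, h fun w => w.1.2, h fun w => w.2.1, h fun w => w.2.2]
  simp only [Fin.sum_univ_two, star_add, star_mul']
  ring

lemma expect_onQubit {N : ℕ} (O : Fin N → Quad → ℂ) (c : Fin N) (a : Quad → ℂ)
    (U : Matrix (Fin 2) (Fin 2) ℂ) (ψ : Bits N → ℂ) :
    expect (Function.update O c a) ((onQubit c U).mulVec ψ) =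
      expect (Function.update O c (conjOp U a)) ψ := by
  simp only [expect_update, amp_onQubit, conjOp, Finset.mul_sum, Finset.sum_mul]
  rw [← Fintype.sum_prod_type', ← Fintype.sum_prod_type']
  have hinv : Function.Involutive fun y : (Fin N → Quad) × Quad =>
      (Function.update y.1 c y.2, y.1 c) := by
    rintro ⟨z, w⟩
    simp
  rw [← Equiv.sum_comp (hinv.toPerm _)]
  refine Finset.sum_congr rfl fun y _ => ?_
  have e : ∏ i ∈ Finset.univ.erase c, O i (Function.update y.1 c y.2 i) =
      ∏ i ∈ Finset.univ.erase c, O i (y.1 i) := by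
    refine Finset.prod_congr rfl fun i hi => ?_
    rw [Function.update_of_ne (Finset.ne_of_mem_erase hi)]
  simp only [Function.Involutive.coe_toPerm, Function.update_self, Function.update_idem,
    Function.update_eq_self, e]
  ring

lemma conjOp_mul_self (U : Matrix (Fin 2) (Fin 2) ℂ) (k : ℂ) (f : Fin 2 → Fin 2 → ℂ) (z : Quad) :
    conjOp U (fun w => k * f w.1.1 w.2.1 * f w.1.2 w.2.2) z =
      k * (∑ a, ∑ b, star (U a z.1.1) * f a b * U b z.2.1) *
        ∑ a, ∑ b, star (U a z.1.2) * f a b * U b z.2.2 := by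
  simp only [conjOp, conjKernel, Fintype.sum_prod_type, Fin.sum_univ_two]
  ring

lemma star_mul_entry {U : Matrix (Fin 2) (Fin 2) ℂ} (hU : U ∈ Matrix.unitaryGroup (Fin 2) ℂ)
    (i j : Fin 2) : star (U 0 i) * U 0 j + star (U 1 i) * U 1 j = if i = j then 1 else 0 := by
  have := congrFun (congrFun (Matrix.mem_unitaryGroup_iff'.1 hU) i) j
  rw [Matrix.mul_apply, Fin.sum_univ_two, Matrix.one_apply] at this
  exact this

lemma conjOp_pauliSq_zero {U : Matrix (Fin 2) (Fin 2) ℂ}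
    (hU : U ∈ Matrix.unitaryGroup (Fin 2) ℂ) : conjOp U (pauliSq 0 0) = pauliSq 0 0 := by
  funext z
  have e1 := star_mul_entry hU z.1.1 z.2.1
  have e2 := star_mul_entry hU z.1.2 z.2.2
  have : conjOp U (pauliSq 0 0) z = (star (U 0 z.1.1) * U 0 z.2.1 + star (U 1 z.1.1) * U 1 z.2.1) *
      (star (U 0 z.1.2) * U 0 z.2.2 + star (U 1 z.1.2) * U 1 z.2.2) := by
    simp only [conjOp, conjKernel, Fintype.sum_prod_type, Fin.sum_univ_two, pauliSq_zero]
    simp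
    ring
  rw [this, e1, e2, pauliSq_zero, mul_ite, mul_one, mul_zero]
  simp only [Prod.ext_iff]
  split_ifs <;> tauto

lemma conjOp_swapOp {U : Matrix (Fin 2) (Fin 2) ℂ}
    (hU : U ∈ Matrix.unitaryGroup (Fin 2) ℂ) : conjOp U swapOp = swapOp := by
  funext z
  have e1 := star_mul_entry hU z.1.1 z.2.2
  have e2 := star_mul_entry hU z.1.2 z.2.1
  have : conjOp U swapOp z = (star (U 0 z.1.1) * U 0 z.2.2 + star (U 1 z.1.1) * U 1 z.2.2) *
      (star (U 0 z.1.2) * U 0 z.2.1 + star (U 1 z.1.2) * U 1 z.2.1) := by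
    simp only [conjOp, conjKernel, Fintype.sum_prod_type, Fin.sum_univ_two, swapOp]
    simp
    ring
  rw [this, e1, e2, swapOp, mul_ite, mul_one, mul_zero]
  simp only [Prod.ext_iff, Prod.fst_swap, Prod.snd_swap]
  split_ifs <;> tauto

/-- The operator `pauliAvg` is a combination of the identity and the swap of the two copies, and
so commutes with `U ⊗ U`. -/
lemma conjOp_pauliAvg {U : Matrix (Fin 2) (Fin 2) ℂ}
    (hU : U ∈ Matrix.unitaryGroup (Fin 2) ℂ) : conjOp U pauliAvg = pauliAvg := by
  have h : pauliAvg = fun z => 2 / 3 * swapOp z - 1 / 3 * pauliSq 0 0 z := by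
    funext z; rw [swapOp_eq]; ring
  funext z
  have e1 := congrFun (conjOp_swapOp hU) z
  have e2 := congrFun (conjOp_pauliSq_zero hU) z
  rw [h]
  simp only
  rw [← e1, ← e2]
  simp only [conjOp, Finset.mul_sum, ← Finset.sum_sub_distrib]
  exact Finset.sum_congr rfl fun w _ => by ring

/-- A Clifford unitary whose conjugation permutes `X`, `Y` and `Z` cyclically up to signs. -/
noncomputable def clifford : Matrix (Fin 2) (Fin 2) ℂ :=
  !![⟨1 / 2, 1 / 2⟩, ⟨1 / 2, -1 / 2⟩; ⟨1 / 2, 1 / 2⟩, ⟨-1 / 2, 1 / 2⟩]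

lemma clifford_mem : clifford ∈ Matrix.unitaryGroup (Fin 2) ℂ := by
  rw [Matrix.mem_unitaryGroup_iff']
  ext i j
  fin_cases i <;> fin_cases j <;>
    simp [clifford, Matrix.mul_apply, Fin.sum_univ_two, Matrix.star_apply, Complex.ext_iff] <;>
    norm_num

lemma conjOp_clifford :
    conjOp clifford (pauliSq 0 1) = pauliSq 1 1 ∧ conjOp clifford (pauliSq 1 0) = pauliSq 0 1 := by
  have key : ∀ (p q p' q' : Fin 2) (κ : ℂ),
      κ ^ 2 * (-1) ^ (p.val * q.val) = (-1) ^ (p'.val * q'.val) →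
      (∀ i j, ∑ a, ∑ b, star (clifford a i) * (pauliEntry p q a b : ℂ) * clifford b j =
        κ * pauliEntry p' q' i j) → conjOp clifford (pauliSq p q) = pauliSq p' q' := by
    intro p q p' q' κ hκ h
    have e : pauliSq p q = fun w => (-1 : ℂ) ^ (p.val * q.val) * (pauliEntry p q w.1.1 w.2.1 : ℂ) *
        (pauliEntry p q w.1.2 w.2.2 : ℂ) := by
      funext w; simp [pauliSq]
    funext z
    rw [e, conjOp_mul_self clifford _ fun a b => (pauliEntry p q a b : ℂ), h, h, pauliSq]
    push_cast
    rw [← hκ]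
    ring
  constructor
  · refine key 0 1 1 1 (-Complex.I) (by simp) fun i j => ?_
    fin_cases i <;> fin_cases j <;>
      simp [clifford, pauliEntry, Fin.sum_univ_two, Complex.ext_iff] <;> norm_num
  · refine key 1 0 0 1 1 (by simp) fun i j => ?_
    fin_cases i <;> fin_cases j <;>
      simp [clifford, pauliEntry, Fin.sum_univ_two, Complex.ext_iff] <;> norm_num

/-! ### Measurability and boundedness -/

lemma measurable_entry (i j : Fin 2) :
    Measurable fun U : U2 => (U : Matrix (Fin 2) (Fin 2) ℂ) i j := by
  have : Continuous fun U : U2 => (U : Matrix (Fin 2) (Fin 2) ℂ) i j :=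
    (continuous_id.matrix_elem i j).comp continuous_subtype_val
  exact this.measurable

lemma measurable_onQubit {N : ℕ} (c : Fin N) (x y : Bits N) :
    Measurable fun U : U2 => onQubit c (U : Matrix (Fin 2) (Fin 2) ℂ) x y := by
  unfold onQubit
  split_ifs
  exacts [measurable_entry _ _, measurable_const]

lemma measurable_stepOp {N : ℕ} (x y : Bits N) :
    Measurable fun γ : StepData N => stepOp γ x y := by
  refine measurable_from_prod_countable_left fun p => ?_
  simp only [stepOp, Matrix.mul_apply]
  refine Finset.measurable_sum _ fun w _ => measurable_const.mul ?_
  refine Finset.measurable_sum _ fun v _ => ?_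
  exact ((measurable_onQubit _ _ _).comp measurable_fst).mul
    ((measurable_onQubit _ _ _).comp measurable_snd)

lemma norm_onQubit_le {N : ℕ} (c : Fin N) (U : U2) (x y : Bits N) :
    ‖onQubit c (U : Matrix (Fin 2) (Fin 2) ℂ) x y‖ ≤ 1 := by
  unfold onQubit
  split_ifs
  · exact entry_norm_bound_of_unitary U.2 _ _
  · simp

lemma norm_mul_apply_le {ι : Type*} [Fintype ι] {A B : Matrix ι ι ℂ} {a b : ℝ}
    (hA : ∀ x y, ‖A x y‖ ≤ a) (hB : ∀ x y, ‖B x y‖ ≤ b) (x y : ι) :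
    ‖(A * B) x y‖ ≤ Fintype.card ι * (a * b) := by
  rw [Matrix.mul_apply]
  refine (norm_sum_le _ _).trans ?_
  have : ∀ w ∈ (Finset.univ : Finset ι), ‖A x w * B w y‖ ≤ a * b := by
    intro w _
    rw [norm_mul]
    exact mul_le_mul (hA _ _) (hB _ _) (norm_nonneg _) ((norm_nonneg _).trans (hA x w))
  simpa using Finset.sum_le_card_nsmul _ _ _ this

lemma norm_mulVec_apply_le {ι : Type*} [Fintype ι] {A : Matrix ι ι ℂ} {v : ι → ℂ} {a R : ℝ}
    (hA : ∀ x y, ‖A x y‖ ≤ a) (hv : ∀ x, ‖v x‖ ≤ R) (x : ι) :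
    ‖A.mulVec v x‖ ≤ Fintype.card ι * (a * R) := by
  rw [Matrix.mulVec, dotProduct]
  refine (norm_sum_le _ _).trans ?_
  have : ∀ w ∈ (Finset.univ : Finset ι), ‖A x w * v w‖ ≤ a * R := by
    intro w _
    rw [norm_mul]
    exact mul_le_mul (hA _ _) (hv _) (norm_nonneg _) ((norm_nonneg _).trans (hA x w))
  simpa using Finset.sum_le_card_nsmul _ _ _ this

lemma exists_norm_stepOp_le (N : ℕ) :
    ∃ K : ℝ, ∀ (γ : StepData N) (x y : Bits N), ‖stepOp γ x y‖ ≤ K := by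
  refine ⟨_, fun γ => norm_mul_apply_le (a := 1) (fun x y => ?_)
    (norm_mul_apply_le (norm_onQubit_le _ _) (norm_onQubit_le _ _))⟩
  unfold cnot
  split_ifs <;> simp

lemma exists_norm_evolve_le {N : ℕ} (ψ₀ : QState N) (n : ℕ) :
    ∃ R : ℝ, ∀ (g : ℕ → StepData N) (x : Bits N), ‖(evolve g ψ₀ n).ofLp x‖ ≤ R := by
  induction n with
  | zero => exact ⟨∑ x, ‖ψ₀.ofLp x‖, fun g x =>
      Finset.single_le_sum (f := fun x => ‖ψ₀.ofLp x‖) (fun _ _ => norm_nonneg _)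
        (Finset.mem_univ x)⟩
  | succ n ih =>
    obtain ⟨R, hR⟩ := ih
    obtain ⟨K, hK⟩ := exists_norm_stepOp_le N
    exact ⟨_, fun g => norm_mulVec_apply_le (hK (g n)) (hR g)⟩

lemma measurable_mulVec {α ι : Type*} [MeasurableSpace α] [Fintype ι] {A : α → Matrix ι ι ℂ}
    {v : α → ι → ℂ} (hA : ∀ x y, Measurable fun ω => A ω x y) (hv : ∀ x, Measurable fun ω => v ω x)
    (x : ι) : Measurable fun ω => (A ω).mulVec (v ω) x := by
  simp only [Matrix.mulVec, dotProduct]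
  exact Finset.measurable_sum _ fun y _ => (hA x y).mul (hv y)

lemma measurable_evolve {N : ℕ} (ψ₀ : QState N) (n : ℕ) (x : Bits N) :
    Measurable fun g : ℕ → StepData N => (evolve g ψ₀ n).ofLp x := by
  induction n generalizing x with
  | zero => simp only [evolve]; exact measurable_const
  | succ n ih =>
    have hn : Measurable fun g : ℕ → StepData N => g n := measurable_pi_apply n
    have hA : ∀ x y, Measurable fun g : ℕ → StepData N => stepOp (g n) x y :=
      fun x y => (measurable_stepOp x y).comp hn
    exact measurable_mulVec hA ih x

lemma evolve_congr {N : ℕ} {g g' : ℕ → StepData N} (ψ₀ : QState N) {n : ℕ}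
    (h : ∀ k < n, g k = g' k) : evolve g ψ₀ n = evolve g' ψ₀ n := by
  induction n with
  | zero => rfl
  | succ n ih =>
    rw [evolve, evolve, ih fun k hk => h k (hk.trans n.lt_succ_self), h n n.lt_succ_self]

lemma measurable_expect {α : Type*} [MeasurableSpace α] {N : ℕ} (O : Fin N → Quad → ℂ)
    {φ : α → Bits N → ℂ} (hφ : ∀ x, Measurable fun ω => φ ω x) :
    Measurable fun ω => expect O (φ ω) := by
  unfold expect amp
  refine Finset.measurable_sum _ fun z _ => Measurable.mul_const ?_ _
  exact (((continuous_star.measurable.comp (hφ _)).mul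
    (continuous_star.measurable.comp (hφ _))).mul (hφ _)).mul (hφ _)

lemma integrable_expect {α : Type*} [MeasurableSpace α] {ν : Measure α} [IsFiniteMeasure ν] {N : ℕ}
    (O : Fin N → Quad → ℂ) {φ : α → Bits N → ℂ} {R : ℝ} (hφ : ∀ x, Measurable fun ω => φ ω x)
    (hR : ∀ ω x, ‖φ ω x‖ ≤ R) : Integrable (fun ω => expect O (φ ω)) ν := by
  refine Integrable.of_bound (measurable_expect O hφ).aestronglyMeasurable
    (∑ z : Fin N → Quad, R ^ 4 * ‖∏ i, O i (z i)‖) (Filter.Eventually.of_forall fun ω => ?_)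
  refine (norm_sum_le _ _).trans (Finset.sum_le_sum fun z _ => ?_)
  rw [norm_mul]
  gcongr
  exact amp_norm_le (hR ω) z

/-! ### Averages over the random gate -/

instance : IsProbabilityMeasure haarU2 :=
  ⟨Measure.haarMeasure_self (K₀ := (⊤ : TopologicalSpace.PositiveCompacts U2))⟩

instance : haarU2.IsMulLeftInvariant := by
  unfold haarU2; infer_instance

/-- The Haar average of `σ ⊗ σ` over conjugations. -/
noncomputable def twirl (j : Fin 2 × Fin 2) : Quad → ℂ :=
  if j = (0, 0) then pauliSq 0 0 else pauliAvg

lemma integrable_expect_onQubit {N : ℕ} (O : Fin N → Quad → ℂ) (c : Fin N) (ψ : Bits N → ℂ) :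
    Integrable (fun U : U2 => expect O ((onQubit c (U : Matrix (Fin 2) (Fin 2) ℂ)).mulVec ψ))
      haarU2 :=
  integrable_expect O (measurable_mulVec (measurable_onQubit c) fun _ => measurable_const)
    fun U => norm_mulVec_apply_le (norm_onQubit_le c U) fun x =>
      Finset.single_le_sum (f := fun x => ‖ψ x‖) (fun _ _ => norm_nonneg _) (Finset.mem_univ x)

lemma pauliAvg_eq_sum : pauliAvg =
    fun z => ∑ j ∈ {((0 : Fin 2), (1 : Fin 2)), (1, 0), (1, 1)},
      (1 / 3 : ℂ) * pauliSq j.1 j.2 z := by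
  funext z
  rw [Finset.sum_insert (by decide), Finset.sum_insert (by decide), Finset.sum_singleton, pauliAvg]
  ring

/-- The Haar average over one-qubit unitaries. By left invariance, the averages belonging to `X`,
`Y` and `Z` agree; and their mean does not depend on the unitary. -/
lemma integral_expect_onQubit {N : ℕ} (O : Fin N → Quad → ℂ) (c : Fin N) (j : Fin 2 × Fin 2)
    (ψ : Bits N → ℂ) :
    ∫ U : U2, expect (Function.update O c (pauliSq j.1 j.2))
        ((onQubit c (U : Matrix (Fin 2) (Fin 2) ℂ)).mulVec ψ) ∂haarU2 =
      expect (Function.update O c (twirl j)) ψ := by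
  set F : Fin 2 × Fin 2 → ℂ := fun j => ∫ U : U2, expect (Function.update O c (pauliSq j.1 j.2))
        ((onQubit c (U : Matrix (Fin 2) (Fin 2) ℂ)).mulVec ψ) ∂haarU2 with hF
  have hleft : ∀ j j' : Fin 2 × Fin 2, conjOp clifford (pauliSq j.1 j.2) = pauliSq j'.1 j'.2 →
      F j = F j' := by
    intro j j' h
    have := integral_mul_left_eq_self (μ := haarU2)
      (fun U : U2 => expect (Function.update O c (pauliSq j.1 j.2))
        ((onQubit c (U : Matrix (Fin 2) (Fin 2) ℂ)).mulVec ψ)) ⟨clifford, clifford_mem⟩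
    simp only [Submonoid.coe_mul, onQubit_mul_mulVec, expect_onQubit _ _ _ clifford, h] at this
    exact this.symm
  have h1 : F (0, 1) = F (1, 1) := hleft (0, 1) (1, 1) conjOp_clifford.1
  have h2 : F (1, 0) = F (0, 1) := hleft (1, 0) (0, 1) conjOp_clifford.2
  have havg : 1 / 3 * (F (0, 1) + F (1, 0) + F (1, 1)) =
      expect (Function.update O c pauliAvg) ψ := by
    have hconst : ∫ U : U2, expect (Function.update O c pauliAvg)
        ((onQubit c (U : Matrix (Fin 2) (Fin 2) ℂ)).mulVec ψ) ∂haarU2 =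
        expect (Function.update O c pauliAvg) ψ := by
      simp [expect_onQubit, conjOp_pauliAvg (Subtype.prop _)]
    rw [← hconst, pauliAvg_eq_sum]
    simp only [expect_update_sum]
    rw [integral_finsetSum _ fun j _ => (integrable_expect_onQubit _ c ψ).const_mul _]
    simp only [integral_const_mul]
    rw [Finset.sum_insert (by decide), Finset.sum_insert (by decide), Finset.sum_singleton]
    simp only [hF]
    ring
  change F j = _
  by_cases h0 : j = (0, 0)
  · subst h0
    simp [hF, twirl, expect_onQubit, conjOp_pauliSq_zero (Subtype.prop _)]
  · rw [twirl, if_neg h0, ← havg]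
    have hj : j = (0, 1) ∨ j = (1, 0) ∨ j = (1, 1) := by
      revert h0; revert j; decide
    rcases hj with rfl | rfl | rfl
    · rw [h2, ← h1]; ring
    · rw [h2, ← h1]; ring
    · rw [h2, ← h1]; ring

lemma integrable_expect_onQubit_onQubit {N : ℕ} (O : Fin N → Quad → ℂ) (c d : Fin N)
    (ψ : Bits N → ℂ) :
    Integrable (fun W : U2 × U2 => expect O ((onQubit c (W.1 : Matrix (Fin 2) (Fin 2) ℂ)).mulVec
      ((onQubit d (W.2 : Matrix (Fin 2) (Fin 2) ℂ)).mulVec ψ))) (haarU2.prod haarU2) :=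
  integrable_expect O
    (measurable_mulVec (fun x y => (measurable_onQubit c x y).comp measurable_fst)
      (measurable_mulVec (fun x y => (measurable_onQubit d x y).comp measurable_snd)
        fun _ => measurable_const))
    fun W => norm_mulVec_apply_le (norm_onQubit_le c W.1)
      (norm_mulVec_apply_le (norm_onQubit_le d W.2) fun x =>
        Finset.single_le_sum (f := fun x => ‖ψ x‖) (fun _ _ => norm_nonneg _) (Finset.mem_univ x))

lemma integral_expect_onQubit_onQubit {N : ℕ} (O : Fin N → Quad → ℂ) {c d : Fin N} (hcd : c ≠ d)
    (j l : Fin 2 × Fin 2) (ψ : Bits N → ℂ) :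
    ∫ W : U2 × U2, expect (Function.update (Function.update O c (pauliSq j.1 j.2)) d
        (pauliSq l.1 l.2)) ((onQubit c (W.1 : Matrix (Fin 2) (Fin 2) ℂ)).mulVec
          ((onQubit d (W.2 : Matrix (Fin 2) (Fin 2) ℂ)).mulVec ψ)) ∂(haarU2.prod haarU2) =
      expect (Function.update (Function.update O c (twirl j)) d (twirl l)) ψ := by
  rw [integral_prod_symm _ (integrable_expect_onQubit_onQubit _ c d ψ)]
  simp only [Function.update_comm (β := fun _ => Quad → ℂ) hcd (pauliSq j.1 j.2),
    integral_expect_onQubit, Function.update_comm (β := fun _ => Quad → ℂ) hcd (twirl j)]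
  simp only [Function.update_comm (β := fun _ => Quad → ℂ) hcd.symm (pauliSq l.1 l.2),
    Function.update_comm (β := fun _ => Quad → ℂ) hcd.symm _ (twirl j),
    integral_expect_onQubit]

/-- The two-copy operator of one qubit inside or outside a support. -/
noncomputable def siteOp (b : Bool) : Quad → ℂ := if b then pauliAvg else pauliSq 0 0

/-- The Pauli labels averaged over in `siteOp`. -/
def siteLabels (b : Bool) : Finset (Fin 2 × Fin 2) :=
  if b then {(0, 1), (1, 0), (1, 1)} else {(0, 0)}

lemma siteOp_eq_sum (b : Bool) : siteOp b = fun z => ∑ j ∈ siteLabels b,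
    ((siteWeight b)⁻¹ : ℂ) * pauliSq j.1 j.2 z := by
  cases b
  · funext z; simp [siteOp, siteLabels, siteWeight]
  · have := pauliAvg_eq_sum
    simp only [one_div] at this
    simpa [siteOp, siteLabels, siteWeight] using this

lemma twirl_eq_siteOp (j : Fin 2 × Fin 2) : twirl j = siteOp (decide (j ≠ (0, 0))) := by
  unfold twirl siteOp
  by_cases h : j = (0, 0) <;> simp [h]

lemma siteOp_comp_setPair {N : ℕ} (c d : Fin N) (a b : Bool) (T : Fin N → Bool) :
    siteOp ∘ setPair c d a b T =
      Function.update (Function.update (siteOp ∘ T) c (siteOp a)) d (siteOp b) := by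
  rw [setPair, Function.comp_update, Function.comp_update]

/-- The average over the Pauli strings with support `T` of the squared expectation values
in the state `ψ`. -/
noncomputable def profileOf {N : ℕ} (ψ : Bits N → ℂ) (T : Fin N → Bool) : ℝ :=
  (expect (siteOp ∘ T) ψ).re

lemma expect_siteOp_cnot {N : ℕ} {c d : Fin N} (hcd : c ≠ d) (φ : Bits N → ℂ)
    (T : Fin N → Bool) :
    expect (siteOp ∘ T) ((cnot c d).mulVec φ) =
      ∑ l ∈ siteLabels (T d), ((siteWeight (T d))⁻¹ : ℂ) *
        ∑ j ∈ siteLabels (T c), ((siteWeight (T c))⁻¹ : ℂ) *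
        expect (Function.update (Function.update (siteOp ∘ T) c (pauliSq j.1 (j.2 + l.2))) d
          (pauliSq (l.1 + j.1) l.2)) φ := by
  have hT : siteOp ∘ T = Function.update (Function.update (siteOp ∘ T) c (siteOp (T c))) d
      (siteOp (T d)) := by
    rw [← siteOp_comp_setPair]; simp [setPair]
  conv_lhs => rw [hT, siteOp_eq_sum (T d), expect_update_sum]
  refine Finset.sum_congr rfl fun l _ => congrArg (HMul.hMul _) ?_
  rw [Function.update_comm (β := fun _ => Quad → ℂ) hcd, siteOp_eq_sum (T c), expect_update_sum]
  refine Finset.sum_congr rfl fun j _ => congrArg (HMul.hMul _) ?_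
  rw [Function.update_comm (β := fun _ => Quad → ℂ) hcd.symm, expect_cnot hcd]

lemma integral_expect_gate {N : ℕ} {c d : Fin N} (hcd : c ≠ d) (ψ : Bits N → ℂ)
    (T : Fin N → Bool) :
    (∫ W : U2 × U2, expect (siteOp ∘ T) ((stepOp (W, ⟨(c, d), hcd⟩)).mulVec ψ)
      ∂(haarU2.prod haarU2)).re = gateStep c d (profileOf ψ) T := by
  have hint : ∫ W : U2 × U2, expect (siteOp ∘ T) ((stepOp (W, ⟨(c, d), hcd⟩)).mulVec ψ)
      ∂(haarU2.prod haarU2) = ∑ l ∈ siteLabels (T d), ((siteWeight (T d))⁻¹ : ℂ) *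
        ∑ j ∈ siteLabels (T c), ((siteWeight (T c))⁻¹ : ℂ) *
        expect (siteOp ∘ setPair c d (decide ((j.1, j.2 + l.2) ≠ ((0 : Fin 2), (0 : Fin 2))))
          (decide ((l.1 + j.1, l.2) ≠ ((0 : Fin 2), (0 : Fin 2)))) T) ψ := by
    simp only [stepOp, ← Matrix.mulVec_mulVec, expect_siteOp_cnot hcd]
    rw [integral_finsetSum _ fun l _ => Integrable.const_mul (integrable_finsetSum _ fun j _ =>
      Integrable.const_mul (integrable_expect_onQubit_onQubit _ c d ψ) _) _]
    refine Finset.sum_congr rfl fun l _ => ?_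
    rw [integral_const_mul, integral_finsetSum _ fun j _ =>
      Integrable.const_mul (integrable_expect_onQubit_onQubit _ c d ψ) _]
    refine congrArg (HMul.hMul _) (Finset.sum_congr rfl fun j _ => ?_)
    rw [integral_const_mul, integral_expect_onQubit_onQubit (siteOp ∘ T) hcd (j.1, j.2 + l.2)
      (l.1 + j.1, l.2), twirl_eq_siteOp, twirl_eq_siteOp, siteOp_comp_setPair]
  rw [hint]
  have hself : setPair c d (T c) (T d) T = T := by simp [setPair]
  have s3 : ∀ f : Fin 2 × Fin 2 → ℂ, ∑ j ∈ siteLabels true, f j =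
      f (0, 1) + f (1, 0) + f (1, 1) := by
    intro f
    rw [siteLabels, if_pos rfl, Finset.sum_insert (by decide), Finset.sum_insert (by decide),
      Finset.sum_singleton, add_assoc]
  have s1 : ∀ f : Fin 2 × Fin 2 → ℂ, ∑ j ∈ siteLabels false, f j = f (0, 0) := by
    intro f; simp [siteLabels]
  have h11 : (1 : Fin 2) + 1 = 0 := by decide
  have hthird : ∀ x : ℂ, ((3 : ℂ)⁻¹ * x).re = 1 / 3 * x.re := by
    intro x
    rw [show (3 : ℂ)⁻¹ = ((1 / 3 : ℝ) : ℂ) by push_cast; ring, Complex.re_ofReal_mul]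
  unfold gateStep profileOf
  cases hc : T c <;> cases hd : T d <;> rw [hc, hd] at hself <;>
    simp [s3, s1, siteWeight, hself, h11, hthird] <;> ring

lemma qubitPair_nonempty {N : ℕ} (hN : 2 ≤ N) : Nonempty (QubitPair N) :=
  ⟨⟨(⟨0, by omega⟩, ⟨1, by omega⟩), by simp⟩⟩

lemma integral_uniformOn_univ {ι : Type*} [Fintype ι] [MeasurableSpace ι]
    [MeasurableSingletonClass ι] (G : ι → ℂ) :
    ∫ i, G i ∂(uniformOn Set.univ) = (∑ i, G i) / Fintype.card ι := by
  simp [uniformOn, ProbabilityTheory.cond, integral_smul_measure, integral_count,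
    Measure.count_univ, ENat.card_eq_coe_fintype_card, div_eq_inv_mul]

lemma isProbabilityMeasure_stepLaw {N : ℕ} (hN : 2 ≤ N) : IsProbabilityMeasure (stepLaw N) := by
  have := qubitPair_nonempty hN
  unfold stepLaw
  infer_instance

/-- One random step acts on the profile of a fixed state by `avgStep`. -/
lemma integral_expect_stepLaw {N : ℕ} (hN : 2 ≤ N) (ψ : Bits N → ℂ) (T : Fin N → Bool) :
    (∫ γ, expect (siteOp ∘ T) ((stepOp γ).mulVec ψ) ∂(stepLaw N)).re =
      avgStep (profileOf ψ) T := by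
  have := qubitPair_nonempty hN
  obtain ⟨K, hK⟩ := exists_norm_stepOp_le N
  have hint : Integrable (fun γ : StepData N => expect (siteOp ∘ T) ((stepOp γ).mulVec ψ))
      ((haarU2.prod haarU2).prod (uniformOn Set.univ)) :=
    integrable_expect _ (measurable_mulVec measurable_stepOp fun _ => measurable_const)
      fun γ => norm_mulVec_apply_le (hK γ) fun x =>
        Finset.single_le_sum (f := fun x => ‖ψ x‖) (fun _ _ => norm_nonneg _) (Finset.mem_univ x)
  rw [stepLaw, integral_prod_symm _ hint, integral_uniformOn_univ, avgStep, ← card_qubitPair,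
    Complex.div_natCast_re, Complex.re_sum]
  congr 1
  exact Finset.sum_congr rfl fun p _ => integral_expect_gate p.2 ψ T

/-! ### Independence of the steps -/

section Independence

variable {N : ℕ} {Ω : Type*} [MeasurableSpace Ω] {P : Measure Ω} [IsProbabilityMeasure P]
  {g : ℕ → Ω → StepData N}

lemma measurable_evolve_comp (hg : ∀ k, Measurable (g k)) (ψ₀ : QState N) (n : ℕ) (x : Bits N) :
    Measurable fun ω => (evolve (fun k => g k ω) ψ₀ n).ofLp x :=
  (measurable_evolve ψ₀ n x).comp (measurable_pi_lambda _ hg)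

lemma integrable_expect_evolve (hg : ∀ k, Measurable (g k)) (ψ₀ : QState N) (n : ℕ)
    (O : Fin N → Quad → ℂ) :
    Integrable (fun ω => expect O (evolve (fun k => g k ω) ψ₀ n).ofLp) P := by
  obtain ⟨R, hR⟩ := exists_norm_evolve_le ψ₀ n
  exact integrable_expect O (measurable_evolve_comp hg ψ₀ n) fun ω => hR _

/-- The state after `n` steps is independent of step `n`, which may hence be averaged over
separately. -/
lemma integral_expect_evolve_succ (hN : 2 ≤ N) (hg : ∀ k, Measurable (g k))
    (hind : iIndepFun g P) (hlaw : ∀ k, Measure.map (g k) P = stepLaw N) (ψ₀ : QState N) (n : ℕ)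
    (O : Fin N → Quad → ℂ) :
    ∫ ω, expect O (evolve (fun k => g k ω) ψ₀ (n + 1)).ofLp ∂P =
      ∫ ω, ∫ γ, expect O ((stepOp γ).mulVec (evolve (fun k => g k ω) ψ₀ n).ofLp) ∂(stepLaw N)
        ∂P := by
  classical
  have := isProbabilityMeasure_stepLaw hN
  have hne : Nonempty (StepData N) := ⟨((1, 1), (qubitPair_nonempty hN).some)⟩
  -- the first `n` steps, extended by arbitrary constant data
  let ext : ({k // k ∈ Finset.range n} → StepData N) → ℕ → StepData N :=
    fun y k => if h : k ∈ Finset.range n then y ⟨k, h⟩ else hne.some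
  have hext : Measurable ext := by
    refine measurable_pi_lambda _ fun k => ?_
    by_cases h : k ∈ Finset.range n
    · simpa only [ext, h, dite_true] using measurable_pi_apply (⟨k, h⟩ : {k // k ∈ Finset.range n})
    · simpa only [ext, h, dite_false] using measurable_const
  let Y : Ω → {k // k ∈ Finset.range n} → StepData N := fun ω i => g i ω
  have hY : Measurable Y := measurable_pi_lambda _ fun i => hg i
  have hev : ∀ ω, evolve (fun k => g k ω) ψ₀ n = evolve (ext (Y ω)) ψ₀ n := by
    intro ω
    refine evolve_congr ψ₀ fun k hk => ?_
    simp [ext, Y, hk]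
  have hindep : IndepFun (g n) Y P := by
    have h := hind.indepFun_finset {n} (Finset.range n) (by simp) hg
    exact h.comp (measurable_pi_apply
      (⟨n, Finset.mem_singleton_self n⟩ : {k // k ∈ ({n} : Finset ℕ)}))
      measurable_id
  have hmap : Measure.map (fun ω => (g n ω, Y ω)) P = (stepLaw N).prod (Measure.map Y P) := by
    rw [(indepFun_iff_map_prod_eq_prod_map_map (hg n).aemeasurable hY.aemeasurable).1 hindep, hlaw]
  have : IsProbabilityMeasure (Measure.map Y P) := Measure.isProbabilityMeasure_map hY.aemeasurable
  obtain ⟨R, hR⟩ := exists_norm_evolve_le ψ₀ n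
  obtain ⟨K, hK⟩ := exists_norm_stepOp_le N
  set G : StepData N × ({k // k ∈ Finset.range n} → StepData N) → ℂ :=
    fun q => expect O ((stepOp q.1).mulVec (evolve (ext q.2) ψ₀ n).ofLp) with hG
  have hφ : ∀ x, Measurable fun q : StepData N × ({k // k ∈ Finset.range n} → StepData N) =>
      (stepOp q.1).mulVec (evolve (ext q.2) ψ₀ n).ofLp x :=
    measurable_mulVec (fun x y => (measurable_stepOp x y).comp measurable_fst)
      fun x => (measurable_evolve ψ₀ n x).comp (hext.comp measurable_snd)
  have hGm : Measurable G := measurable_expect O hφ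
  have hGi : Integrable G ((stepLaw N).prod (Measure.map Y P)) :=
    integrable_expect O hφ fun q => norm_mulVec_apply_le (hK q.1) (hR _)
  calc ∫ ω, expect O (evolve (fun k => g k ω) ψ₀ (n + 1)).ofLp ∂P
      = ∫ ω, G (g n ω, Y ω) ∂P := by
        simp only [hG, ← hev, evolve]
    _ = ∫ q, G q ∂(Measure.map (fun ω => (g n ω, Y ω)) P) :=
        (integral_map ((hg n).prodMk hY).aemeasurable hGm.aestronglyMeasurable).symm
    _ = ∫ y, ∫ γ, G (γ, y) ∂(stepLaw N) ∂(Measure.map Y P) := by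
        rw [hmap, integral_prod_symm _ hGi]
    _ = ∫ ω, ∫ γ, G (γ, Y ω) ∂(stepLaw N) ∂P := by
        refine integral_map hY.aemeasurable ?_
        exact (hGm.stronglyMeasurable.integral_prod_left').aestronglyMeasurable
    _ = _ := by simp only [hG, ← hev]

lemma integrable_profileOf (hg : ∀ k, Measurable (g k)) (ψ₀ : QState N) (n : ℕ)
    (T : Fin N → Bool) :
    Integrable (fun ω => profileOf (evolve (fun k => g k ω) ψ₀ n).ofLp T) P :=
  (integrable_expect_evolve hg ψ₀ n _).re

lemma integral_profileOf_succ (hN : 2 ≤ N) (hg : ∀ k, Measurable (g k))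
    (hind : iIndepFun g P) (hlaw : ∀ k, Measure.map (g k) P = stepLaw N) (ψ₀ : QState N) (n : ℕ) :
    (fun T => ∫ ω, profileOf (evolve (fun k => g k ω) ψ₀ (n + 1)).ofLp T ∂P) =
      avgStep fun T => ∫ ω, profileOf (evolve (fun k => g k ω) ψ₀ n).ofLp T ∂P := by
  have hgate : ∀ (p : QubitPair N) (T : Fin N → Bool),
      Integrable (fun ω => gateStep p.1.1 p.1.2
        (profileOf (evolve (fun k => g k ω) ψ₀ n).ofLp) T) P ∧
      ∫ ω, gateStep p.1.1 p.1.2 (profileOf (evolve (fun k => g k ω) ψ₀ n).ofLp) T ∂P =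
        gateStep p.1.1 p.1.2
          (fun T => ∫ ω, profileOf (evolve (fun k => g k ω) ψ₀ n).ofLp T ∂P) T := by
    intro p T
    have hi := integrable_profileOf (P := P) hg ψ₀ n
    unfold gateStep
    split_ifs
    · refine ⟨(((hi _).const_mul _).add ((hi _).const_mul _)).add ((hi _).const_mul _), ?_⟩
      have hx := (hi (setPair p.1.1 p.1.2 true false T)).const_mul (2 / 9)
      have hy := (hi (setPair p.1.1 p.1.2 false true T)).const_mul (2 / 9)
      refine (integral_add (hx.add hy) ((hi T).const_mul (5 / 9))).trans ?_
      simp only [Pi.add_apply]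
      rw [integral_add hx hy]
      simp only [integral_const_mul]
    · refine ⟨((hi _).const_mul _).add ((hi _).const_mul _), ?_⟩
      rw [integral_add ((hi _).const_mul _) ((hi _).const_mul _)]
      simp only [integral_const_mul]
    · refine ⟨((hi _).const_mul _).add ((hi _).const_mul _), ?_⟩
      rw [integral_add ((hi _).const_mul _) ((hi _).const_mul _)]
      simp only [integral_const_mul]
    · exact ⟨hi _, rfl⟩
  have := isProbabilityMeasure_stepLaw hN
  funext T
  have hre : ∀ m, ∫ ω, profileOf (evolve (fun k => g k ω) ψ₀ m).ofLp T ∂P =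
      (∫ ω, expect (siteOp ∘ T) (evolve (fun k => g k ω) ψ₀ m).ofLp ∂P).re := fun m =>
    integral_re (integrable_expect_evolve hg ψ₀ m _)
  obtain ⟨R, hR⟩ := exists_norm_evolve_le ψ₀ n
  obtain ⟨K, hK⟩ := exists_norm_stepOp_le N
  have hφ : ∀ x, Measurable fun q : Ω × StepData N =>
      (stepOp q.2).mulVec (evolve (fun k => g k q.1) ψ₀ n).ofLp x :=
    measurable_mulVec (fun x y => (measurable_stepOp x y).comp measurable_snd)
      fun x => (measurable_evolve_comp hg ψ₀ n x).comp measurable_fst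
  have hinner : Integrable (fun ω => ∫ γ, expect (siteOp ∘ T)
      ((stepOp γ).mulVec (evolve (fun k => g k ω) ψ₀ n).ofLp) ∂(stepLaw N)) P :=
    (integrable_expect (ν := P.prod (stepLaw N)) (siteOp ∘ T) hφ
      fun q => norm_mulVec_apply_le (hK q.2) (hR _)).integral_prod_left
  rw [hre, integral_expect_evolve_succ hN hg hind hlaw]
  have h2 : (∫ ω, ∫ γ, expect (siteOp ∘ T)
      ((stepOp γ).mulVec (evolve (fun k => g k ω) ψ₀ n).ofLp) ∂(stepLaw N) ∂P).re =
      ∫ ω, avgStep (profileOf (evolve (fun k => g k ω) ψ₀ n).ofLp) T ∂P := by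
    simp only [← integral_expect_stepLaw hN]
    exact (integral_re hinner).symm
  rw [h2]
  unfold avgStep
  rw [integral_div, integral_finsetSum _ fun p _ => (hgate p T).1]
  simp only [fun p => (hgate p T).2]

end Independence

/-! ### The purity in terms of Pauli profiles -/

lemma sum_arrow_prod {ι α β M : Type*} [Fintype ι] [DecidableEq ι] [Fintype α] [Fintype β]
    [AddCommMonoid M] (F : (ι → α) → (ι → β) → M) :
    ∑ z : ι → α × β, F (fun i => (z i).1) (fun i => (z i).2) = ∑ v, ∑ u, F v u := by
  rw [← (Equiv.arrowProdEquivProdArrow ι (fun _ => α) (fun _ => β)).symm.sum_comp,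
    Fintype.sum_prod_type]
  rfl

/-- The coefficients of the swap (for a qubit of `A`) or the identity (for other qubits) with
respect to the operators `siteOp`. -/
noncomputable def swapCoeff (inA t : Bool) : ℝ :=
  if inA then (if t then 3 / 2 else 1 / 2) else (if t then 0 else 1)

/-- The coefficients of the purity on `A` with respect to the profile of the state. -/
noncomputable def purityCoeff {N : ℕ} (A : Finset (Fin N)) (T : Fin N → Bool) : ℝ :=
  ∏ i, swapCoeff (decide (i ∈ A)) (T i)

/-- The operator exchanging the two copies of the qubits in `A`. -/
noncomputable def swapOn {N : ℕ} (A : Finset (Fin N)) (i : Fin N) : Quad → ℂ :=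
  if i ∈ A then swapOp else pauliSq 0 0

lemma expect_swapOn {N : ℕ} (A : Finset (Fin N)) (ψ : Bits N → ℂ) :
    expect (swapOn A) ψ = ∑ y : Bits N, ∑ y' : Bits N,
      star (ψ (A.piecewise y' y)) * star (ψ (A.piecewise y y')) * ψ y * ψ y' := by
  have hprod : ∀ z : Fin N → Quad, ∏ i, swapOn A i (z i) =
      if (fun i => (z i).1) = fun i => if i ∈ A then (z i).2.swap else (z i).2 then 1 else 0 := by
    intro z
    have : ∀ i, swapOn A i (z i) =
        if (z i).1 = (if i ∈ A then (z i).2.swap else (z i).2) then 1 else 0 := by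
      intro i
      unfold swapOn
      by_cases hi : i ∈ A <;> simp [hi, swapOp, pauliSq_zero]
    simp only [this, Finset.prod_ite_zero, Finset.prod_const_one, funext_iff, Finset.mem_univ,
      true_implies]
  unfold expect
  simp only [hprod]
  refine (sum_arrow_prod fun v u : Fin N → Fin 2 × Fin 2 =>
    star (ψ fun i => (v i).1) * star (ψ fun i => (v i).2) * ψ (fun i => (u i).1) *
      ψ (fun i => (u i).2) *
      if v = fun i => if i ∈ A then (u i).swap else u i then 1 else 0).trans ?_
  rw [Finset.sum_comm]
  simp only [mul_ite, mul_one, mul_zero, Finset.sum_ite_eq', Finset.mem_univ, if_true]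
  refine Eq.trans (Finset.sum_congr rfl fun u _ => ?_) (sum_arrow_prod fun y y' : Bits N =>
    star (ψ (A.piecewise y' y)) * star (ψ (A.piecewise y y')) * ψ y * ψ y')
  congr 5 <;>
  · funext i
    by_cases hi : i ∈ A <;> simp [hi]

lemma trace_reduce_mul_self {N : ℕ} (A : Finset (Fin N)) (ψ : QState N) :
    (reduce A (ketbra ψ) * reduce A (ketbra ψ)).trace = expect (swapOn A) ψ.ofLp := by
  have hsum : ∀ F : Bits N → ℂ, ∑ y, F y = ∑ a, ∑ b, F (glue A a b) := by
    intro F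
    rw [← (Equiv.piEquivPiSubtypeProd (fun i => i ∈ A) (fun _ => Fin 2)).symm.sum_comp,
      Fintype.sum_prod_type]
    rfl
  have hpw : ∀ a b a' b', A.piecewise (glue A a' b') (glue A a b) = glue A a' b := by
    intro a b a' b'
    funext i
    by_cases hi : i ∈ A <;> simp [hi, glue]
  rw [expect_swapOn, hsum]
  simp only [hsum fun y => star _ * _ * _ * _]
  simp only [Matrix.trace, Matrix.diag, Matrix.mul_apply, reduce, ketbra, Finset.sum_mul_sum,
    hpw]
  refine Finset.sum_congr rfl fun a _ => ?_
  rw [Finset.sum_comm]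
  refine Finset.sum_congr rfl fun b _ => Finset.sum_congr rfl fun a' _ =>
    Finset.sum_congr rfl fun b' _ => ?_
  ring

lemma expect_swapOn_eq_sum {N : ℕ} (A : Finset (Fin N)) (ψ : Bits N → ℂ) :
    expect (swapOn A) ψ = ∑ T : Fin N → Bool, (purityCoeff A T : ℂ) * expect (siteOp ∘ T) ψ := by
  have h : ∀ i z, swapOn A i z =
      ∑ t, (swapCoeff (decide (i ∈ A)) t : ℂ) * siteOp t z := by
    intro i z
    by_cases hi : i ∈ A
    · simp [swapOn, hi, swapCoeff, siteOp, swapOp_eq]; ring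
    · simp [swapOn, hi, swapCoeff, siteOp]
  unfold expect purityCoeff
  simp only [h, ← sum_prod_sites fun i t => (swapCoeff (decide (i ∈ A)) t : ℂ) * siteOp t _,
    Finset.mul_sum]
  rw [Finset.sum_comm]
  refine Finset.sum_congr rfl fun T _ => Finset.sum_congr rfl fun z _ => ?_
  rw [Finset.prod_mul_distrib]
  push_cast
  simp only [Function.comp_apply]
  ring

lemma purity_eq_sum {N : ℕ} (A : Finset (Fin N)) (ψ : QState N) :
    purity A ψ = ∑ T, purityCoeff A T * profileOf ψ.ofLp T := by
  rw [purity, trace_reduce_mul_self, expect_swapOn_eq_sum, Complex.re_sum]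
  simp only [Complex.re_ofReal_mul, profileOf]

lemma sum_purityCoeff {N : ℕ} (A : Finset (Fin N)) :
    ∑ T, purityCoeff A T = (2 : ℝ) ^ A.card := by
  have : ∀ i : Fin N, ∑ t, swapCoeff (decide (i ∈ A)) t = if i ∈ A then 2 else 1 := by
    intro i
    by_cases hi : i ∈ A <;> norm_num [hi, swapCoeff]
  unfold purityCoeff
  rw [sum_prod_sites fun (i : Fin N) t => swapCoeff (decide (i ∈ A)) t]
  simp only [this, Finset.prod_ite_mem, Finset.univ_inter, Finset.prod_const]

lemma purityCoeff_bot {N : ℕ} (A : Finset (Fin N)) : purityCoeff A ⊥ = ((2 : ℝ) ^ A.card)⁻¹ := by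
  have : ∀ i : Fin N, swapCoeff (decide (i ∈ A)) ((⊥ : Fin N → Bool) i) =
      if i ∈ A then (2 : ℝ)⁻¹ else 1 := by
    intro i
    by_cases hi : i ∈ A <;> simp [hi, swapCoeff]
  unfold purityCoeff
  simp only [this, Finset.prod_ite_mem, Finset.univ_inter, Finset.prod_const, inv_pow]

lemma sum_purityCoeff_sq_div {N : ℕ} (A : Finset (Fin N)) :
    ∑ T, purityCoeff A T ^ 2 / weight T = 1 := by
  unfold purityCoeff weight
  simp only [← Finset.prod_pow, ← Finset.prod_div_distrib]
  rw [sum_prod_sites fun (i : Fin N) t => swapCoeff (decide (i ∈ A)) t ^ 2 / siteWeight t]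
  refine Finset.prod_eq_one fun i _ => ?_
  by_cases hi : i ∈ A <;> norm_num [hi, swapCoeff, siteWeight]

lemma purityCoeff_univ {N : ℕ} (T : Fin N → Bool) :
    purityCoeff Finset.univ T = weight T / 2 ^ N := by
  have : ∀ i, swapCoeff (decide (i ∈ (Finset.univ : Finset (Fin N)))) (T i) =
      siteWeight (T i) / 2 := by
    intro i
    cases h : T i <;> norm_num [swapCoeff, siteWeight]
  unfold purityCoeff weight
  rw [Finset.prod_congr rfl fun i _ => this i, Finset.prod_div_distrib]
  simp

lemma sum_purityCoeff_mul_stationary {N : ℕ} (A : Finset (Fin N)) :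
    ∑ T, purityCoeff A T * stationary T =
      ((2 : ℝ) ^ A.card + (2 : ℝ) ^ (Aᶜ).card) / ((2 : ℝ) ^ N + 1) := by
  have h : ∀ T : Fin N → Bool, purityCoeff A T * stationary T =
      (purityCoeff A T * (1 / (2 ^ N + 1)) +
        if T = ⊥ then purityCoeff A ⊥ * (1 - 1 / (2 ^ N + 1)) else 0) := by
    intro T
    by_cases hT : T = ⊥
    · simp [hT, stationary]; ring
    · simp [hT, stationary]
  have hN : (2 : ℝ) ^ N = 2 ^ A.card * 2 ^ (Aᶜ).card := by
    rw [← pow_add, Finset.card_add_card_compl, Fintype.card_fin]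
  simp only [h, Finset.sum_add_distrib, ← Finset.sum_mul, sum_purityCoeff, purityCoeff_bot,
    Finset.sum_ite_eq', Finset.mem_univ, if_true]
  rw [hN]
  field_simp
  ring

/-! ### The profile of the initial state -/

lemma expect_swapOn_eq_one {N : ℕ} {ψ : Bits N → ℂ} (hψ : ∑ x, ‖ψ x‖ ^ 2 = 1)
    {A : Finset (Fin N)} (hA : A = ∅ ∨ A = Finset.univ) :
    expect (swapOn A) ψ = 1 := by
  have h1 : ∑ x, star (ψ x) * ψ x = 1 := by
    have : ∀ x, star (ψ x) * ψ x = ((‖ψ x‖ ^ 2 : ℝ) : ℂ) := by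
      intro x
      rw [mul_comm]
      simpa using Complex.mul_conj' (ψ x)
    simp only [this]
    rw [← Complex.ofReal_sum, hψ, Complex.ofReal_one]
  have h2 : expect (swapOn A) ψ = (∑ y, star (ψ y) * ψ y) * ∑ y, star (ψ y) * ψ y := by
    rw [expect_swapOn, Finset.sum_mul_sum]
    refine Finset.sum_congr rfl fun y _ => Finset.sum_congr rfl fun y' _ => ?_
    rcases hA with rfl | rfl
    · rw [Finset.piecewise_empty, Finset.piecewise_empty]; ring
    · rw [Finset.piecewise_univ, Finset.piecewise_univ]; ring
  rw [h2, h1, one_mul]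

lemma profileOf_bot {N : ℕ} {ψ : Bits N → ℂ} (hψ : ∑ x, ‖ψ x‖ ^ 2 = 1) :
    profileOf ψ ⊥ = 1 := by
  have : siteOp ∘ (⊥ : Fin N → Bool) = swapOn ∅ := by
    funext i; simp [siteOp, swapOn]
  rw [profileOf, this, expect_swapOn_eq_one hψ (Or.inl rfl), Complex.one_re]

lemma sum_weight_mul_profileOf {N : ℕ} {ψ : Bits N → ℂ} (hψ : ∑ x, ‖ψ x‖ ^ 2 = 1) :
    ∑ T, weight T * profileOf ψ T = 2 ^ N := by
  have h := congrArg Complex.re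
    ((expect_swapOn_eq_sum _ ψ).symm.trans (expect_swapOn_eq_one hψ (Or.inr rfl)))
  simp only [Complex.re_sum, Complex.re_ofReal_mul, purityCoeff_univ, Complex.one_re,
    div_mul_eq_mul_div, ← Finset.sum_div] at h
  rw [div_eq_one_iff_eq (by positivity)] at h
  exact h

lemma sum_norm_siteOp_le (b : Bool) (v : Fin 2 × Fin 2) :
    ∑ u, ‖siteOp b (v, u)‖ ≤ 1 ∧ ∑ u, ‖siteOp b (u, v)‖ ≤ 1 := by
  have hid : ∀ z : Quad, ‖pauliSq 0 0 z‖ = if z.1 = z.2 then 1 else 0 := by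
    intro z; rw [pauliSq_zero]; split_ifs <;> simp
  cases b
  · simp [siteOp, hid]
  · have hle : ∀ z : Quad, ‖pauliAvg z‖ ≤
        (if z.1 = z.2.swap then 2 / 3 else 0) + if z.1 = z.2 then 1 / 3 else 0 := by
      intro z
      have : pauliAvg z = 2 / 3 * swapOp z - 1 / 3 * pauliSq 0 0 z := by rw [swapOp_eq]; ring
      rw [this]
      refine (norm_sub_le _ _).trans (le_of_eq ?_)
      rw [norm_mul, norm_mul, hid, swapOp]
      split_ifs <;> simp
    have hs : ∀ u : Fin 2 × Fin 2, v = u.swap ↔ u = v.swap := by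
      intro u
      constructor <;> (rintro rfl; simp)
    constructor
    · refine (Finset.sum_le_sum fun u _ => hle (v, u)).trans ?_
      simp only [hs, Finset.sum_add_distrib, Finset.sum_ite_eq, Finset.sum_ite_eq', Finset.mem_univ,
        if_true]
      norm_num
    · refine (Finset.sum_le_sum fun u _ => hle (u, v)).trans ?_
      simp only [Finset.sum_add_distrib, Finset.sum_ite_eq', Finset.mem_univ, if_true]
      norm_num

/-- Schur's test: the absolute row and column sums of the operators `siteOp` are at most one. -/
lemma abs_profileOf_le {N : ℕ} {ψ : Bits N → ℂ} (hψ : ∑ x, ‖ψ x‖ ^ 2 = 1)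
    (T : Fin N → Bool) : |profileOf ψ T| ≤ 1 := by
  set α : (Fin N → Fin 2 × Fin 2) → ℝ := fun v =>
    ‖ψ fun i => (v i).1‖ ^ 2 * ‖ψ fun i => (v i).2‖ ^ 2 with hα
  have hα1 : ∑ v, α v = 1 := by
    refine (sum_arrow_prod fun y y' : Bits N => ‖ψ y‖ ^ 2 * ‖ψ y'‖ ^ 2).trans ?_
    simp only [← Finset.mul_sum, hψ, mul_one]
  have hrow : ∀ v : Fin N → Fin 2 × Fin 2, ∑ u : Fin N → Fin 2 × Fin 2,
      ∏ i, ‖siteOp (T i) (v i, u i)‖ ≤ 1 := by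
    intro v
    rw [sum_prod_sites fun (i : Fin N) u => ‖siteOp (T i) (v i, u)‖]
    exact Finset.prod_le_one (fun _ _ => Finset.sum_nonneg fun _ _ => norm_nonneg _)
      fun i _ => (sum_norm_siteOp_le (T i) (v i)).1
  have hcol : ∀ u : Fin N → Fin 2 × Fin 2, ∑ v : Fin N → Fin 2 × Fin 2,
      ∏ i, ‖siteOp (T i) (v i, u i)‖ ≤ 1 := by
    intro u
    rw [sum_prod_sites fun (i : Fin N) v => ‖siteOp (T i) (v, u i)‖]
    exact Finset.prod_le_one (fun _ _ => Finset.sum_nonneg fun _ _ => norm_nonneg _)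
      fun i _ => (sum_norm_siteOp_le (T i) (u i)).2
  have hamp : ∀ z : Fin N → Quad,
      ‖amp ψ z‖ ≤ 1 / 2 * (α (fun i => (z i).1) + α fun i => (z i).2) := by
    intro z
    simp only [amp, norm_mul, norm_star, hα]
    nlinarith [sq_nonneg (‖ψ fun i => (z i).1.1‖ * ‖ψ fun i => (z i).1.2‖ -
      ‖ψ fun i => (z i).2.1‖ * ‖ψ fun i => (z i).2.2‖)]
  have key : ‖expect (siteOp ∘ T) ψ‖ ≤ 1 := by
    calc ‖expect (siteOp ∘ T) ψ‖
        ≤ ∑ z : Fin N → Quad, 1 / 2 * (α (fun i => (z i).1) + α fun i => (z i).2) *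
          ∏ i, ‖siteOp (T i) ((z i).1, (z i).2)‖ := by
          refine (norm_sum_le _ _).trans (Finset.sum_le_sum fun z _ => ?_)
          rw [norm_mul, norm_prod]
          exact mul_le_mul_of_nonneg_right (hamp z) (Finset.prod_nonneg fun _ _ => norm_nonneg _)
      _ = ∑ v, ∑ u, 1 / 2 * (α v + α u) * ∏ i, ‖siteOp (T i) (v i, u i)‖ :=
          sum_arrow_prod fun v u => 1 / 2 * (α v + α u) * ∏ i, ‖siteOp (T i) (v i, u i)‖
      _ = 1 / 2 * ∑ v, α v * ∑ u : Fin N → Fin 2 × Fin 2, ∏ i, ‖siteOp (T i) (v i, u i)‖ +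
          1 / 2 * ∑ u, α u * ∑ v : Fin N → Fin 2 × Fin 2, ∏ i, ‖siteOp (T i) (v i, u i)‖ := by
          simp only [Finset.mul_sum]
          rw [Finset.sum_comm (f := fun u v : Fin N → Fin 2 × Fin 2 =>
            1 / 2 * (α u * ∏ i, ‖siteOp (T i) (v i, u i)‖)), ← Finset.sum_add_distrib]
          refine Finset.sum_congr rfl fun v _ => ?_
          rw [← Finset.sum_add_distrib]
          exact Finset.sum_congr rfl fun u _ => by ring
      _ ≤ 1 / 2 * ∑ v, α v * 1 + 1 / 2 * ∑ u, α u * 1 := by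
          gcongr with v _ u _
          exacts [hrow v, hcol u]
      _ = 1 := by simp only [mul_one, hα1]; norm_num
  exact (Complex.abs_re_le_norm _).trans key

end RandomCircuit

theorem lemma1 {N : ℕ} (hN : 2 ≤ N) (A : Finset (Fin N))
    {Ω : Type*} [MeasurableSpace Ω] (P : MeasureTheory.Measure Ω)
    [MeasureTheory.IsProbabilityMeasure P]
    (g : ℕ → Ω → RandomCircuit.StepData N)
    (hg_meas : ∀ k, Measurable (g k))
    (hg_indep : ProbabilityTheory.iIndepFun g P)
    (hg_law : ∀ k, MeasureTheory.Measure.map (g k) P = RandomCircuit.stepLaw N)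
    (ψ₀ : RandomCircuit.QState N) (hψ₀ : ‖ψ₀‖ = 1) (n : ℕ) :
    MeasureTheory.Integrable
      (fun ω => RandomCircuit.purity A (RandomCircuit.evolve (fun k => g k ω) ψ₀ n)) P ∧
    |(∫ ω, RandomCircuit.purity A (RandomCircuit.evolve (fun k => g k ω) ψ₀ n) ∂P) -
        ((2 : ℝ) ^ A.card + (2 : ℝ) ^ (Aᶜ).card) / ((2 : ℝ) ^ N + 1)| ≤
      (4 : ℝ) ^ N * Real.exp (-(4 * (n : ℝ)) / (9 * (N : ℝ) * ((N : ℝ) - 1))) := by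
  open RandomCircuit in
  have hN2 : (2 : ℝ) ≤ N := by exact_mod_cast hN
  have hN1 : 0 < (N : ℝ) - 1 := by linarith
  have hψ : ∑ x, ‖ψ₀.ofLp x‖ ^ 2 = 1 := by
    rw [← EuclideanSpace.norm_sq_eq, hψ₀, one_pow]
  have hint : ∀ T, Integrable (fun ω => purityCoeff A T *
      profileOf (evolve (fun k => g k ω) ψ₀ n).ofLp T) P :=
    fun T => (integrable_profileOf hg_meas ψ₀ n T).const_mul _
  simp only [purity_eq_sum]
  refine ⟨integrable_finsetSum _ fun T _ => hint T, ?_⟩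
  set s : ℕ → (Fin N → Bool) → ℝ := fun n T =>
    ∫ ω, profileOf (evolve (fun k => g k ω) ψ₀ n).ofLp T ∂P with hs
  have hs0 : s 0 = profileOf ψ₀.ofLp := by
    funext T
    simp [hs, evolve]
  have hconv := sum_weight_mul_sub_stationary_sq_le hN (s := s)
    (fun n => integral_profileOf_succ hN hg_meas hg_indep hg_law ψ₀ n)
    (by rw [hs0, profileOf_bot hψ]) (by rw [hs0, sum_weight_mul_profileOf hψ])
    (by rw [hs0]; exact abs_profileOf_le hψ) n
  have hdiff : (∫ ω, ∑ T, purityCoeff A T * profileOf (evolve (fun k => g k ω) ψ₀ n).ofLp T ∂P) -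
      ((2 : ℝ) ^ A.card + (2 : ℝ) ^ (Aᶜ).card) / ((2 : ℝ) ^ N + 1) =
      ∑ T, purityCoeff A T * (s n T - stationary T) := by
    rw [integral_finsetSum _ fun T _ => hint T, ← sum_purityCoeff_mul_stationary,
      ← Finset.sum_sub_distrib]
    simp only [integral_const_mul, mul_sub, hs]
  rw [hdiff]
  -- Cauchy–Schwarz with respect to the weight
  have hcs : (∑ T, purityCoeff A T * (s n T - stationary T)) ^ 2 ≤
      (∑ T, purityCoeff A T ^ 2 / weight T) * ∑ T, weight T * (s n T - stationary T) ^ 2 := by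
    refine Finset.sum_sq_le_sum_mul_sum_of_sq_le_mul _
      (fun T _ => div_nonneg (sq_nonneg _) (weight_pos T).le)
      (fun T _ => mul_nonneg (weight_pos T).le (sq_nonneg _)) fun T _ => ?_
    have := (weight_pos T).ne'
    exact le_of_eq (by field_simp)
  rw [sum_purityCoeff_sq_div, one_mul] at hcs
  refine abs_le_of_sq_le_sq ?_ (by positivity)
  refine hcs.trans (hconv.trans ?_)
  rw [mul_pow, ← Real.exp_nat_mul]
  have hexp : Real.exp (-(16 * n / (9 * N * ((N : ℝ) - 1)))) ≤
      Real.exp ((2 : ℕ) * (-(4 * (n : ℝ)) / (9 * (N : ℝ) * ((N : ℝ) - 1)))) := by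
    rw [Real.exp_le_exp]
    have : 0 ≤ (n : ℝ) / (9 * N * (N - 1)) := by positivity
    have e1 : (16 * n / (9 * N * ((N : ℝ) - 1))) = 16 * ((n : ℝ) / (9 * N * (N - 1))) := by ring
    have e2 : -(4 * (n : ℝ)) / (9 * (N : ℝ) * ((N : ℝ) - 1)) =
      -4 * ((n : ℝ) / (9 * N * (N - 1))) := by ring
    rw [e1, e2]
    push_cast
    linarith
  have h4 : 4 * (4 : ℝ) ^ N ≤ (4 ^ N) ^ 2 := by
    have : (4 : ℝ) ^ 1 ≤ 4 ^ N := pow_le_pow_right₀ (by norm_num) (by omega)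
    rw [sq]
    gcongr
    simpa using this
  gcongr
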